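/- Let $c>0$ and $\xi\in(-c^2/2,\,c^2/3)$. Then there is a unique $a=a(\xi)\in(0,c)$ with $$\int_{a}^{0}\Big(\xi+\frac{c^2-a^2}{2}-s^2\Big)\sqrt{\frac{s^2-a^2}{c^2-s^2}}\,ds=0$$ (principal square root). Let $\mathcal R(\lambda)=\sqrt{\lambda(\lambda+c^2)(\lambda+a^2)}$ on the elliptic Riemann surface $\mathbb M(\xi)$ of $y^2=\lambda(\lambda+c^2)(\lambda+a^2)$, cut along $[-c^2,-a^2]\cup[0,\infty)$, with $\mathcal R>0$ on the upper side of $[0,\infty)$ on the upper sheet. The cycle $\mathfrak b$ surrounds $[-c^2,-a^2]$ clockwise on the upper sheet; the cycle $\mathfrak a$ runs from $-a^2$ to $0$ on the lower sheet and back from $0$ to $-a^2$ on the upper sheet. Put $$h(\xi)=\int_{\mathfrak a}\frac{\lambda\,d\lambda}{\mathcal R(\lambda)}\Big(\int_{\mathfrak a}\frac{d\lambda}{\mathcal R(\lambda)}\Big)^{-1},\qquad d\Omega_1=\frac{\mathrm i}{2}\frac{\lambda-h}{\mathcal R(\lambda)}\,d\lambda,\qquad d\Omega_3=-\frac{3\mathrm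 i}{2}\frac{(\lambda-\nu_1)(\lambda-\nu_2)}{\mathcal R(\lambda)}\,d\lambda,$$ where $\nu_1,\nu_2\in\mathbb R$ are such that $\int_{\mathfrak a}d\Omega_3=0$ and $2\nu_1+2\nu_2+c^2+a^2=0$ (such $\nu_1,\nu_2$ exist), and define $V(\xi),W(\xi)$ by $\mathrm iV=\int_{\mathfrak b}d\Omega_1$, $\mathrm iW=\int_{\mathfrak b}d\Omega_3$. Further let $$B(\xi)=24\int_{a(\xi)}^{c}\Big(\xi+\frac{c^2-a^2(\xi)}{2}-s^2\Big)\sqrt{\frac{s^2-a^2(\xi)}{c^2-s^2}}\,ds,\qquad \Gamma(\xi)=-\frac12\Big(\int_{-a(\xi)}^{a(\xi)}\frac{ds}{\sqrt{(c^2-s^2)(a^2(\xi)-s^2)}}\Big)^{-1},$$ $$z(\xi)=\tfrac12\big(12\xi(c^2-a(\xi)^2)+3c^4+9a(\xi)^4-6a(\xi)^2c^2\big).$$ Then $V(\xi)$, $W(\xi)$, $h(\xi)$ are real, $B$ and $z$ are differentiable at $\xi$, and: 1. $tB(\xi)=-4W(\xi)t+V(\xi)x$ for all real $x$ and $t\neq0$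 with $\xi=\frac{x}{12t}$; 2. $B'(\xi)=12V(\xi)$ and $4\pi\Gamma(\xi)=-V(\xi)$; 3. $\frac16z'(\xi)=c^2+a^2(\xi)+2h(\xi)$. -/

import Mathlib

noncomputable section

namespace OneGap

/-- `α` is the band edge at `ξ`: `0 < α < c` and
`∫_α^0 (ξ + (c² - α²)/2 - s²) √((s² - α²)/(c² - s²)) ds = 0`.
The radicand is negative for `0 ≤ s < α`, so the square root is the principal complex one. -/
def IsBandEdge (c ξ α : ℝ) : Prop :=
  0 < α ∧ α < c ∧
    ∫ s in α..0, ((ξ + (c ^ 2 - α ^ 2) / 2 - s ^ 2 : ℝ) : ℂ) *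
      (((s ^ 2 - α ^ 2) / (c ^ 2 - s ^ 2) : ℝ) : ℂ) ^ (1 / 2 : ℂ) = 0

/-- The function `a(ξ)`. -/
def a (c ξ : ℝ) : ℝ := Classical.epsilon (IsBandEdge c ξ)

/-- The upper-sheet branch of `√(λ(λ + c²)(λ + α²))` with cuts `[-c², -α²]` and `[0, ∞)`,
positive on the upper side of `[0, ∞)`. The powers are principal: `i (-λ)^{1/2}` is the square
root of `λ` with cut `[0, ∞)` that is positive on the upper side of the cut, and the product of the
other two factors is analytic off `[-c², -α²]`. The value on the lower sheet is the negative. -/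
def R (c α : ℝ) (l : ℂ) : ℂ :=
  Complex.I * (-l) ^ (1 / 2 : ℂ) * (l + (c : ℂ) ^ 2) ^ (1 / 2 : ℂ) * (l + (α : ℂ) ^ 2) ^ (1 / 2 : ℂ)

/-- The integral over the cycle `𝔞` of the differential `φ(λ, y) dλ` on the surface
`y² = λ(λ + c²)(λ + α²)`: from `-α²` to `0` on the lower sheet, where `y = -R(λ)`, and back from
`0` to `-α²` on the upper sheet, where `y = R(λ)`. -/
def aPeriod (c α : ℝ) (φ : ℂ → ℂ → ℂ) : ℂ :=
  (∫ l in (-α ^ 2)..0, φ (l : ℂ) (-R c α (l : ℂ))) +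
    ∫ l in (0 : ℝ)..(-α ^ 2), φ (l : ℂ) (R c α (l : ℂ))

/-- The integral over the cycle `𝔟` of the differential `φ(λ, y) dλ`. The cycle surrounds
`[-c², -α²]` clockwise on the upper sheet; it is the circle with centre `-(c² + α²)/2` and radius
`c²/2`, which crosses the real axis at `-c² - α²/2` and in the gap at `-α²/2`. -/
def bPeriod (c α : ℝ) (φ : ℂ → ℂ → ℂ) : ℂ :=
  -∮ l in C(-((c : ℂ) ^ 2 + (α : ℂ) ^ 2) / 2, c ^ 2 / 2), φ l (R c α l)

/-- `h = ∫_𝔞 λ dλ/R (∫_𝔞 dλ/R)⁻¹` for the surface with branch points `-c², -α², 0, ∞`. -/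
def hOf (c α : ℝ) : ℂ :=
  aPeriod c α (fun l y => l / y) * (aPeriod c α (fun _ y => 1 / y))⁻¹

/-- The coefficient of `dΩ₁ = (i/2) (λ - h)/R dλ`. -/
def dOmega1 (c α : ℝ) (l y : ℂ) : ℂ :=
  Complex.I / 2 * ((l - hOf c α) / y)

/-- The coefficient of `-(3i/2) (λ - ν₁)(λ - ν₂)/R dλ`. -/
def dOmega3Form (ν : ℝ × ℝ) (l y : ℂ) : ℂ :=
  -(3 * Complex.I / 2) * ((l - (ν.1 : ℂ)) * (l - (ν.2 : ℂ)) / y)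

/-- The two conditions that fix the pair of zeros `ν₁, ν₂` of `dΩ₃` up to order. -/
def IsZeroPair (c α : ℝ) (ν : ℝ × ℝ) : Prop :=
  2 * ν.1 + 2 * ν.2 + c ^ 2 + α ^ 2 = 0 ∧ aPeriod c α (dOmega3Form ν) = 0

/-- The zeros `ν₁, ν₂` of `dΩ₃`. -/
def nu (c α : ℝ) : ℝ × ℝ := Classical.epsilon (IsZeroPair c α)

/-- The coefficient of `dΩ₃`. -/
def dOmega3 (c α : ℝ) (l y : ℂ) : ℂ := dOmega3Form (nu c α) l y

/-- `h(ξ)`. -/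
def h (c ξ : ℝ) : ℂ := hOf c (a c ξ)

/-- The wave number: `i V = ∫_𝔟 dΩ₁`. -/
def V (c ξ : ℝ) : ℂ := bPeriod c (a c ξ) (dOmega1 c (a c ξ)) / Complex.I

/-- The frequency: `i W = ∫_𝔟 dΩ₃`. -/
def W (c ξ : ℝ) : ℂ := bPeriod c (a c ξ) (dOmega3 c (a c ξ)) / Complex.I

/-- `B(ξ) = 24 ∫_a^c (ξ + (c² - a²)/2 - s²) √((s² - a²)/(c² - s²)) ds`. -/
def B (c ξ : ℝ) : ℝ :=
  24 * ∫ s in (a c ξ)..c, (ξ + (c ^ 2 - a c ξ ^ 2) / 2 - s ^ 2) *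
    √((s ^ 2 - a c ξ ^ 2) / (c ^ 2 - s ^ 2))

/-- `Γ(ξ) = -(1/2) (∫_{-a}^a ((c² - s²)(a² - s²))^{-1/2} ds)⁻¹`. -/
def Gam (c ξ : ℝ) : ℝ :=
  -(1 / 2) * (∫ s in (-a c ξ)..(a c ξ), (√((c ^ 2 - s ^ 2) * (a c ξ ^ 2 - s ^ 2)))⁻¹)⁻¹

/-- `z(ξ)`. -/
def z (c ξ : ℝ) : ℝ :=
  (12 * ξ * (c ^ 2 - a c ξ ^ 2) + 3 * c ^ 4 + 9 * a c ξ ^ 4 - 6 * a c ξ ^ 2 * c ^ 2) / 2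

end OneGap

end

/-!
Put `q = a²`, `C = c²`. The substitutions `λ = -q sin² φ` in the gap `[-q, 0]` and
`-λ = C - (C - q) sin² φ` in the band `[-C, -q]` express every integral of the statement through the
complete elliptic integral `K` and the combination `B = E - (C - q) K` at the moduli `q` and
`C - q`. A differential is normalized when a combination of `K` and `B` at `q` vanishes; Legendre's
relation then evaluates its `𝔟`-period without integrals at the complementary modulus, which gives
`V = π / K` and `W = (C + q) / 2 * V`. The integral that defines `B(ξ)` has a companion over
`[a, 0]`, whose vanishing is the equation of the band edge, and is evaluated in the same way:
`B(ξ) = -4 π q (C - q) / B`.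

The band edge equation reads `ξ = (C + q) / 6 - q (C - q) K / (3 B)`. The derivative of the right
side is a positive multiple of `(4 q - 2 C) B + q (C - q) K`, a function that vanishes at `q = 0`
and has derivative `9 B / 2`. Hence `q` is a differentiable function of `ξ`, and the formulas for
`B'` and `z'` follow by the chain rule.
-/

noncomputable section

namespace OneGap

open Real Set Filter Topology MeasureTheory intervalIntegral

theorem hasDerivAt_intervalIntegral_of_continuousOn {E : Type*} [NormedAddCommGroup E]
    [NormedSpace ℝ E] {F F' : ℝ → ℝ → E} {a b x₀ : ℝ} {U : Set ℝ}
    (hU : U ∈ 𝓝 x₀) (hF : ∀ x ∈ U, ContinuousOn (F x) (uIcc a b))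
    (hF' : ContinuousOn (Function.uncurry F') (U ×ˢ uIcc a b))
    (hd : ∀ x ∈ U, ∀ t ∈ uIcc a b, HasDerivAt (fun y => F y t) (F' x t) x) :
    HasDerivAt (fun x => ∫ t in a..b, F x t) (∫ t in a..b, F' x₀ t) x₀ := by
  obtain ⟨ε, hε, hball⟩ := Metric.nhds_basis_closedBall.mem_iff.1 hU
  have hx₀ : x₀ ∈ U := mem_of_mem_nhds hU
  have hcomp : IsCompact (Metric.closedBall x₀ ε ×ˢ uIcc a b) :=
    (isCompact_closedBall x₀ ε).prod isCompact_uIcc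
  obtain ⟨M, hM⟩ := hcomp.exists_bound_of_continuousOn (hF'.mono (prod_mono_left hball))
  have hF'₀ : ContinuousOn (F' x₀) (uIcc a b) :=
    hF'.comp (f := fun t => (x₀, t)) (by fun_prop) fun t ht => ⟨hx₀, ht⟩
  refine (hasDerivAt_integral_of_dominated_loc_of_deriv_le (F := F) (F' := F') (bound := fun _ => M)
    (Metric.closedBall_mem_nhds x₀ hε) ?_ (hF x₀ hx₀).intervalIntegrable ?_ ?_
    intervalIntegrable_const ?_).2
  · filter_upwards [hU] with x hx
    exact ((hF x hx).mono uIoc_subset_uIcc).aestronglyMeasurable measurableSet_uIoc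
  · exact (hF'₀.mono uIoc_subset_uIcc).aestronglyMeasurable measurableSet_uIoc
  · exact ae_of_all _ fun t ht x hx => hM (x, t) ⟨hx, uIoc_subset_uIcc ht⟩
  · exact ae_of_all _ fun t ht x hx => hd x (hball hx) t (uIoc_subset_uIcc ht)

theorem hasDerivAt_of_strictMonoOn_of_rightInvOn {f g : ℝ → ℝ} {f' x : ℝ} {s t : Set ℝ}
    (hf : StrictMonoOn f s) (hs : s ∈ 𝓝 (g x)) (ht : t ∈ 𝓝 x) (hmaps : MapsTo g t s)
    (hfg : RightInvOn g f t) (hf' : HasDerivAt f f' (g x)) (hne : f' ≠ 0) :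
    HasDerivAt g f'⁻¹ x := by
  have hmono : MonotoneOn g t := fun y hy y' hy' hyy' =>
    (hf.le_iff_le (hmaps hy) (hmaps hy')).1 (by rwa [hfg hy, hfg hy'])
  have hpre : f ⁻¹' t ∈ 𝓝 (g x) :=
    hf'.continuousAt.preimage_mem_nhds (by rwa [hfg (mem_of_mem_nhds ht)])
  have himage : g '' t ∈ 𝓝 (g x) := by
    filter_upwards [hs, hpre] with p hps hpt
    exact ⟨f p, hpt, hf.injOn (hmaps hpt) hps (hfg hpt)⟩
  exact .of_local_left_inverse (continuousAt_of_monotoneOn_of_image_mem_nhds hmono ht himage) hf'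
    hne (eventually_of_mem ht hfg)

/-- The elliptic modulus function `D(φ) = √(C - q sin² φ)`; in the classical notation
`C = c²` and `q = k² c²`. -/
def ellipticDelta (C q φ : ℝ) : ℝ := √(C - q * sin φ ^ 2)

/-- The moments `∫_0^{π/2} D(φ)ⁿ dφ`; for `n = 1` this is the complete elliptic integral of the
second kind, `√C E(k)` in the classical notation. -/
def ellipticMoment (n : ℤ) (C q : ℝ) : ℝ := ∫ φ in (0 : ℝ)..π / 2, ellipticDelta C q φ ^ n

/-- The complete elliptic integral of the first kind, `K(k) / √C` in the classical notation. -/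
def ellipticK (C q : ℝ) : ℝ := ellipticMoment (-1) C q

/-- The combination `E - (C - q) K` of the complete elliptic integrals, that is
`∫_0^{π/2} q cos² φ / D(φ) dφ`. -/
def ellipticB (C q : ℝ) : ℝ := ellipticMoment 1 C q - (C - q) * ellipticK C q

section EllipticIntegrals

variable {C q : ℝ}

theorem sub_mul_sin_sq_pos (hC : 0 < C) (hq : q < C) (φ : ℝ) : 0 < C - q * sin φ ^ 2 := by
  rcases le_or_gt q 0 with hq0 | hq0
  · nlinarith [sq_nonneg (sin φ)]
  · nlinarith [sin_sq_le_one φ]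

theorem ellipticDelta_pos (hC : 0 < C) (hq : q < C) (φ : ℝ) : 0 < ellipticDelta C q φ :=
  sqrt_pos.2 (sub_mul_sin_sq_pos hC hq φ)

theorem ellipticDelta_sq (hC : 0 < C) (hq : q < C) (φ : ℝ) :
    ellipticDelta C q φ ^ 2 = C - q * sin φ ^ 2 :=
  sq_sqrt (sub_mul_sin_sq_pos hC hq φ).le

theorem ellipticDelta_zpow (hC : 0 < C) (hq : q < C) (n : ℤ) (φ : ℝ) :
    ellipticDelta C q φ ^ n = ellipticDelta C q φ ^ (n - 2) * (C - q * sin φ ^ 2) := by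
  rw [← ellipticDelta_sq hC hq, ← zpow_natCast, ← zpow_add₀ (ellipticDelta_pos hC hq φ).ne',
    Nat.cast_two, sub_add_cancel]

theorem continuous_ellipticDelta : Continuous (ellipticDelta C q) := by
  unfold ellipticDelta
  fun_prop

theorem continuous_ellipticDelta_zpow (hC : 0 < C) (hq : q < C) (n : ℤ) :
    Continuous fun φ => ellipticDelta C q φ ^ n :=
  continuous_ellipticDelta.zpow₀ n fun φ => .inl (ellipticDelta_pos hC hq φ).ne'

theorem hasDerivAt_ellipticDelta (hC : 0 < C) (hq : q < C) (φ : ℝ) :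
    HasDerivAt (ellipticDelta C q) (-(q * sin φ * cos φ) / ellipticDelta C q φ) φ := by
  have hrad : HasDerivAt (fun φ => C - q * sin φ ^ 2) (-(2 * (q * sin φ * cos φ))) φ := by
    refine ((((hasDerivAt_sin φ).pow 2).const_mul q).const_sub C).congr_deriv ?_
    push_cast
    ring
  refine (hrad.sqrt (sub_mul_sin_sq_pos hC hq φ).ne').congr_deriv ?_
  rw [← mul_neg, mul_div_mul_left _ _ two_ne_zero]
  rfl

theorem hasDerivAt_ellipticDelta_zpow_left (hC : 0 < C) (hq : q < C) (n : ℤ) (φ : ℝ) :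
    HasDerivAt (fun q => ellipticDelta C q φ ^ n)
      (-(n / 2) * (sin φ ^ 2 * ellipticDelta C q φ ^ (n - 2))) q := by
  have hD := (ellipticDelta_pos hC hq φ).ne'
  have hrad : HasDerivAt (fun q => C - q * sin φ ^ 2) (-sin φ ^ 2) q := by
    simpa using ((hasDerivAt_id q).mul_const (sin φ ^ 2)).const_sub C
  refine ((hasDerivAt_zpow n _ (.inl hD)).comp q
    (hrad.sqrt (sub_mul_sin_sq_pos hC hq φ).ne')).congr_deriv ?_
  change _ * ellipticDelta C q φ ^ (n - 1) * (_ / (2 * ellipticDelta C q φ)) = _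
  rw [show n - 1 = n - 2 + 1 by ring, zpow_add_one₀ hD]
  field_simp

theorem hasDerivAt_ellipticMoment (hC : 0 < C) (hq : q < C) (n : ℤ) :
    HasDerivAt (ellipticMoment n C)
      (∫ φ in (0 : ℝ)..π / 2, -(n / 2) * (sin φ ^ 2 * ellipticDelta C q φ ^ (n - 2))) q := by
  refine hasDerivAt_intervalIntegral_of_continuousOn (Iio_mem_nhds hq)
    (fun p hp => (continuous_ellipticDelta_zpow hC hp n).continuousOn) ?_
    fun p hp φ _ => hasDerivAt_ellipticDelta_zpow_left hC hp n φ
  have hD : Continuous fun x : ℝ × ℝ => ellipticDelta C x.1 x.2 := by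
    unfold ellipticDelta
    fun_prop
  refine ContinuousOn.mul (by fun_prop) (ContinuousOn.mul (by fun_prop) ?_)
  exact hD.continuousOn.zpow₀ _ fun x hx => .inl (ellipticDelta_pos hC hx.1 x.2).ne'

theorem continuousOn_ellipticMoment (hC : 0 < C) (n : ℤ) :
    ContinuousOn (ellipticMoment n C) (Iio C) := fun _ hq =>
  (hasDerivAt_ellipticMoment hC hq n).continuousAt.continuousWithinAt

theorem ellipticMoment_pos (hC : 0 < C) (hq : q < C) (n : ℤ) : 0 < ellipticMoment n C q :=
  intervalIntegral_pos_of_pos ((continuous_ellipticDelta_zpow hC hq n).intervalIntegrable _ _)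
    (fun φ => zpow_pos (ellipticDelta_pos hC hq φ) n) (by positivity)

theorem hasDerivAt_ellipticMoment_of_ne_zero (hC : 0 < C) (hq : q < C) (hq0 : q ≠ 0) (n : ℤ) :
    HasDerivAt (ellipticMoment n C)
      (n * (ellipticMoment n C q - C * ellipticMoment (n - 2) C q) / (2 * q)) q := by
  refine (hasDerivAt_ellipticMoment hC hq n).congr_deriv ?_
  have hint (m : ℤ) : IntervalIntegrable (fun φ => ellipticDelta C q φ ^ m) volume 0 (π / 2) :=
    (continuous_ellipticDelta_zpow hC hq m).intervalIntegrable _ _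
  rw [ellipticMoment, ellipticMoment, ← intervalIntegral.integral_const_mul,
    ← integral_sub (hint n) ((hint _).const_mul C), ← intervalIntegral.integral_const_mul,
    ← intervalIntegral.integral_div]
  refine integral_congr fun φ _ => ?_
  simp only [ellipticDelta_zpow hC hq n]
  field_simp
  ring

/-- Integrate the derivative of `q sin φ cos φ D(φ)ⁿ`. -/
theorem ellipticMoment_add_two (hC : 0 < C) (hq : q < C) (n : ℤ) :
    (n + 2) * ellipticMoment (n + 2) C q =
      (n + 1) * (2 * C - q) * ellipticMoment n C q
        - n * (C * (C - q)) * ellipticMoment (n - 2) C q := by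
  have hint (m : ℤ) (x : ℝ) :
      IntervalIntegrable (fun φ => x * ellipticDelta C q φ ^ m) volume 0 (π / 2) :=
    (continuous_const.mul (continuous_ellipticDelta_zpow hC hq m)).intervalIntegrable _ _
  have hderiv (φ : ℝ) : HasDerivAt (fun φ => q * (sin φ * cos φ) * ellipticDelta C q φ ^ n)
      ((n + 2) * ellipticDelta C q φ ^ (n + 2)
        - (n + 1) * (2 * C - q) * ellipticDelta C q φ ^ n
        + n * (C * (C - q)) * ellipticDelta C q φ ^ (n - 2)) φ := by
    have hD := (ellipticDelta_pos hC hq φ).ne'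
    refine ((((hasDerivAt_sin φ).mul (hasDerivAt_cos φ)).const_mul q).mul
      ((hasDerivAt_zpow n _ (.inl hD)).comp φ
        (hasDerivAt_ellipticDelta hC hq φ))).congr_deriv ?_
    have hn := ellipticDelta_zpow hC hq n φ
    have hn1 : ellipticDelta C q φ ^ (n - 1)
        = ellipticDelta C q φ ^ (n - 2) * ellipticDelta C q φ := by
      rw [← zpow_add_one₀ hD, show n - 2 + 1 = n - 1 by ring]
    have hn2 := ellipticDelta_zpow hC hq (n + 2) φ
    rw [add_sub_cancel_right, hn] at hn2
    simp only [Function.comp_apply, Pi.mul_apply, hn, hn1, hn2]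
    field_simp
    rw [cos_sq']
    ring
  have hftc := integral_eq_sub_of_hasDerivAt (fun φ _ => hderiv φ)
    (((hint _ _).sub (hint _ _)).add (hint _ _) :
      IntervalIntegrable _ volume 0 (π / 2))
  rw [integral_add ((hint _ _).sub (hint _ _)) (hint _ _), integral_sub (hint _ _) (hint _ _)]
    at hftc
  simp only [intervalIntegral.integral_const_mul, cos_pi_div_two, sin_zero, mul_zero, zero_mul,
    sub_zero] at hftc
  unfold ellipticMoment
  linarith

theorem continuousOn_ellipticK (hC : 0 < C) : ContinuousOn (ellipticK C) (Iio C) :=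
  continuousOn_ellipticMoment hC (-1)

theorem continuousOn_ellipticB (hC : 0 < C) : ContinuousOn (ellipticB C) (Iio C) :=
  (continuousOn_ellipticMoment hC 1).sub
    ((continuousOn_const.sub continuousOn_id).mul (continuousOn_ellipticK hC))

theorem ellipticK_pos (hC : 0 < C) (hq : q < C) : 0 < ellipticK C q :=
  ellipticMoment_pos hC hq (-1)

theorem hasDerivAt_ellipticK (hC : 0 < C) (hq : q < C) (hq0 : q ≠ 0) :
    HasDerivAt (ellipticK C) (ellipticB C q / (2 * q * (C - q))) q := by
  refine (hasDerivAt_ellipticMoment_of_ne_zero hC hq hq0 (-1)).congr_deriv ?_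
  have hrec := ellipticMoment_add_two hC hq (-1)
  norm_num at hrec
  have hCq := (sub_pos.2 hq).ne'
  rw [ellipticB, ellipticK, hrec]
  norm_num
  field_simp

theorem hasDerivAt_ellipticB (hC : 0 < C) (hq : q < C) (hq0 : q ≠ 0) :
    HasDerivAt (ellipticB C) (ellipticK C q / 2) q := by
  refine ((hasDerivAt_ellipticMoment_of_ne_zero hC hq hq0 1).sub
    (((hasDerivAt_id q).const_sub C).mul (hasDerivAt_ellipticK hC hq hq0))).congr_deriv ?_
  have hCq := (sub_pos.2 hq).ne'
  simp only [ellipticB, ellipticK, id_eq]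
  norm_num
  field_simp
  ring

theorem ellipticB_eq_integral (hC : 0 < C) (hq : q < C) :
    ellipticB C q = ∫ φ in (0 : ℝ)..π / 2, q * cos φ ^ 2 * (ellipticDelta C q φ)⁻¹ := by
  have hint (n : ℤ) := (continuous_ellipticDelta_zpow hC hq n).intervalIntegrable
    (μ := volume) 0 (π / 2)
  rw [ellipticB, ellipticK, ellipticMoment, ellipticMoment,
    ← intervalIntegral.integral_const_mul, ← integral_sub (hint 1) ((hint _).const_mul _)]
  refine integral_congr fun φ _ => ?_
  have hD := ellipticDelta_pos hC hq φ
  simp only [zpow_one, zpow_neg_one]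
  field_simp
  rw [ellipticDelta_sq hC hq, cos_sq']
  ring

theorem ellipticB_zero (hC : 0 < C) : ellipticB C 0 = 0 := by
  simp [ellipticB_eq_integral hC hC]

theorem ellipticK_zero : ellipticK C 0 = π / (2 * √C) := by
  simp only [ellipticK, ellipticMoment, ellipticDelta, zero_mul, sub_zero, zpow_neg_one,
    intervalIntegral.integral_const, smul_eq_mul]
  ring

end EllipticIntegrals

section Limits

variable {C q : ℝ}

theorem ellipticB_pos (hq0 : 0 < q) (hq : q < C) : 0 < ellipticB C q := by
  have hC := hq0.trans hq
  have hcont : Continuous fun φ => q * cos φ ^ 2 * (ellipticDelta C q φ)⁻¹ :=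
    (by fun_prop : Continuous fun φ => q * cos φ ^ 2).mul
      (continuous_ellipticDelta.inv₀ fun φ => (ellipticDelta_pos hC hq φ).ne')
  rw [ellipticB_eq_integral hC hq]
  refine intervalIntegral_pos_of_pos_on (hcont.intervalIntegrable _ _) (fun φ hφ => ?_)
    (by positivity)
  have hcos := cos_pos_of_mem_Ioo ⟨by linarith [hφ.1, pi_pos], hφ.2⟩
  have hD := ellipticDelta_pos hC hq φ
  positivity

theorem ellipticB_le_mul_ellipticK (hq0 : 0 ≤ q) (hq : q < C) :
    ellipticB C q ≤ q * ellipticK C q := by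
  have hC := hq0.trans_lt hq
  have hinv : Continuous fun φ => (ellipticDelta C q φ)⁻¹ :=
    continuous_ellipticDelta.inv₀ fun φ => (ellipticDelta_pos hC hq φ).ne'
  simp only [ellipticB_eq_integral hC hq, ellipticK, ellipticMoment, zpow_neg_one,
    ← intervalIntegral.integral_const_mul]
  refine integral_mono_on (by positivity)
    (Continuous.intervalIntegrable ((by fun_prop : Continuous fun φ => q * cos φ ^ 2).mul hinv) _ _)
    (Continuous.intervalIntegrable (continuous_const.mul hinv) _ _) fun φ _ => ?_
  have hD := ellipticDelta_pos hC hq φ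
  gcongr
  exact mul_le_of_le_one_right hq0 (cos_sq_le_one φ)

theorem ellipticK_le (hq0 : 0 ≤ q) (hq : q < C) : ellipticK C q ≤ π / 2 / √(C - q) := by
  have hC := hq0.trans_lt hq
  have hCq := sub_pos.2 hq
  have hle (φ : ℝ) : ellipticDelta C q φ ^ (-1 : ℤ) ≤ (√(C - q))⁻¹ := by
    rw [zpow_neg_one]
    refine inv_anti₀ (sqrt_pos.2 hCq) (sqrt_le_sqrt ?_)
    linarith [mul_le_of_le_one_right hq0 (sin_sq_le_one φ)]
  calc ellipticK C q ≤ ∫ _ in (0 : ℝ)..π / 2, (√(C - q))⁻¹ :=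
        integral_mono_on (by positivity)
          ((continuous_ellipticDelta_zpow hC hq _).intervalIntegrable _ _)
          (continuous_const.intervalIntegrable _ _) fun φ _ => hle φ
    _ = π / 2 / √(C - q) := by simp [div_eq_mul_inv]

theorem tendsto_sub_mul_ellipticK (hC : 0 < C) :
    Tendsto (fun q => (C - q) * ellipticK C q) (𝓝[<] C) (𝓝 0) := by
  have hev : ∀ᶠ q in 𝓝[<] C, q ∈ Ioo 0 C := Ioo_mem_nhdsLT hC
  have hbound : Tendsto (fun q => π / 2 * √(C - q)) (𝓝[<] C) (𝓝 0) := by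
    have : Continuous fun q => π / 2 * √(C - q) := by fun_prop
    simpa using (this.tendsto C).mono_left nhdsWithin_le_nhds
  refine squeeze_zero' ?_ ?_ hbound
  · filter_upwards [hev] with q hq
    exact mul_nonneg (sub_pos.2 hq.2).le (ellipticK_pos hC hq.2).le
  · filter_upwards [hev] with q hq
    calc (C - q) * ellipticK C q ≤ (C - q) * (π / 2 / √(C - q)) :=
          mul_le_mul_of_nonneg_left (ellipticK_le hq.1.le hq.2) (sub_pos.2 hq.2).le
      _ = π / 2 * √(C - q) := by rw [mul_div_left_comm, div_sqrt]

theorem ellipticMoment_one_self (hC : 0 ≤ C) : ellipticMoment 1 C C = √C := by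
  have hD : EqOn (fun φ => ellipticDelta C C φ ^ (1 : ℤ)) (fun φ => √C * cos φ)
      (uIcc 0 (π / 2)) := by
    intro φ hφ
    rw [uIcc_of_le (by positivity)] at hφ
    have hcos := cos_nonneg_of_mem_Icc ⟨by linarith [hφ.1, pi_pos], hφ.2⟩
    simp only [zpow_one]
    rw [ellipticDelta, show C - C * sin φ ^ 2 = C * cos φ ^ 2 by rw [cos_sq']; ring,
      sqrt_mul hC, sqrt_sq hcos]
  rw [ellipticMoment, integral_congr hD]
  simp

theorem tendsto_ellipticB (hC : 0 < C) : Tendsto (ellipticB C) (𝓝[<] C) (𝓝 √C) := by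
  have hE : Continuous (ellipticMoment 1 C) := by
    refine continuous_parametric_intervalIntegral_of_continuous' ?_ _ _
    unfold Function.uncurry ellipticDelta
    simp only [zpow_one]
    fun_prop
  have h := ((hE.tendsto C).mono_left nhdsWithin_le_nhds).sub (tendsto_sub_mul_ellipticK hC)
  rwa [ellipticMoment_one_self hC.le, sub_zero] at h

theorem tendsto_legendre (hC : 0 < C) :
    Tendsto (fun q => ellipticK C q * ellipticB C (C - q) + ellipticB C q * ellipticK C (C - q))
      (𝓝[>] 0) (𝓝 (π / 2)) := by
  have hev : ∀ᶠ q in 𝓝[>] 0, q ∈ Ioo 0 C := Ioo_mem_nhdsGT hC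
  have hrefl : Tendsto (fun q => C - q) (𝓝[>] 0) (𝓝[<] C) := by
    refine tendsto_nhdsWithin_iff.2 ⟨?_, by
      filter_upwards [hev] with q hq using sub_lt_self C hq.1⟩
    have : Continuous fun q => C - q := by fun_prop
    simpa using (this.tendsto 0).mono_left nhdsWithin_le_nhds
  have hK : Tendsto (ellipticK C) (𝓝[>] 0) (𝓝 (π / (2 * √C))) := by
    rw [← ellipticK_zero]
    exact ((continuousOn_ellipticK hC).continuousAt (Iio_mem_nhds hC)).mono_left
      nhdsWithin_le_nhds
  have hsmall : Tendsto (fun q => ellipticB C q * ellipticK C (C - q)) (𝓝[>] 0) (𝓝 0) := by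
    have hbound := hK.mul ((tendsto_sub_mul_ellipticK hC).comp hrefl)
    rw [mul_zero] at hbound
    refine squeeze_zero' ?_ ?_ hbound
    · filter_upwards [hev] with q hq
      exact mul_nonneg (ellipticB_pos hq.1 hq.2).le (ellipticK_pos hC (sub_lt_self C hq.1)).le
    · filter_upwards [hev] with q hq
      have hK' := ellipticK_pos hC (sub_lt_self C hq.1)
      calc ellipticB C q * ellipticK C (C - q) ≤ q * ellipticK C q * ellipticK C (C - q) := by
            gcongr
            exact ellipticB_le_mul_ellipticK hq.1.le hq.2
        _ = _ := by simp only [Function.comp_apply, sub_sub_cancel]; ring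
  have h := (hK.mul ((tendsto_ellipticB hC).comp hrefl)).add hsmall
  have hsqrt := (sqrt_pos.2 hC).ne'
  rwa [add_zero, show π / (2 * √C) * √C = π / 2 by field_simp] at h

theorem legendre_relation (hq0 : 0 < q) (hq : q < C) :
    ellipticK C q * ellipticB C (C - q) + ellipticB C q * ellipticK C (C - q) = π / 2 := by
  have hC := hq0.trans hq
  let L (q : ℝ) := ellipticK C q * ellipticB C (C - q) + ellipticB C q * ellipticK C (C - q)
  have hL (p : ℝ) (hp : p ∈ Ioo 0 C) : HasDerivAt L 0 p := by
    have hp' := sub_pos.2 hp.2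
    have hrefl : HasDerivAt (fun p => C - p) (-1) p := (hasDerivAt_id p).const_sub C
    have hK := hasDerivAt_ellipticK hC hp.2 hp.1.ne'
    have hB := hasDerivAt_ellipticB hC hp.2 hp.1.ne'
    have hK' := (hasDerivAt_ellipticK hC (sub_lt_self C hp.1) hp'.ne').comp p hrefl
    have hB' := (hasDerivAt_ellipticB hC (sub_lt_self C hp.1) hp'.ne').comp p hrefl
    refine ((hK.mul hB').add (hB.mul hK')).congr_deriv ?_
    have hp0 := hp.1.ne'
    have hp1 := hp'.ne'
    simp only [Function.comp_apply, sub_sub_cancel]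
    field_simp
    ring
  obtain ⟨l, hl⟩ := isOpen_Ioo.exists_is_const_of_deriv_eq_zero isPreconnected_Ioo
    (fun p hp => (hL p hp).differentiableAt.differentiableWithinAt) fun p hp => (hL p hp).deriv
  have hconst : Tendsto L (𝓝[>] 0) (𝓝 l) :=
    tendsto_const_nhds.congr' (by
      filter_upwards [Ioo_mem_nhdsGT hC] with p hp using (hl p hp).symm)
  exact (hl q ⟨hq0, hq⟩).trans (tendsto_nhds_unique hconst (tendsto_legendre hC))

end Limits

/-- The characteristic speed `x / 12t` of the Whitham modulation with branch points
`-C`, `-q`, `0`; a band edge `α` at `ξ` is a solution of `whithamSpeed c² α² = ξ`. -/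
def whithamSpeed (C q : ℝ) : ℝ := (C + q) / 6 - q * (C - q) * ellipticK C q / (3 * ellipticB C q)

/-- The factor that carries the sign of the derivative of `whithamSpeed C`. -/
def whithamFactor (C q : ℝ) : ℝ :=
  (4 * q - 2 * C) * ellipticB C q + q * (C - q) * ellipticK C q

section WhithamSpeed

variable {C q ξ : ℝ}

theorem hasDerivAt_whithamFactor (hq0 : 0 < q) (hq : q < C) :
    HasDerivAt (whithamFactor C) (9 / 2 * ellipticB C q) q := by
  have hC := hq0.trans hq
  have hK := hasDerivAt_ellipticK hC hq hq0.ne'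
  have hB := hasDerivAt_ellipticB hC hq hq0.ne'
  have hid := hasDerivAt_id q
  refine ((((hid.const_mul 4).sub_const (2 * C)).mul hB).add
    ((hid.mul (hid.const_sub C)).mul hK)).congr_deriv ?_
  have hCq := (sub_pos.2 hq).ne'
  simp only [id_eq, Pi.mul_apply]
  field_simp
  ring

theorem whithamFactor_pos (hq0 : 0 < q) (hq : q < C) : 0 < whithamFactor C q := by
  have hC := hq0.trans hq
  have hsub : Ico 0 C ⊆ Iio C := fun _ hp => hp.2
  have hB := (continuousOn_ellipticB hC).mono hsub
  have hK := (continuousOn_ellipticK hC).mono hsub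
  have hcont : ContinuousOn (whithamFactor C) (Ico 0 C) := by
    unfold whithamFactor
    fun_prop
  have hmono : StrictMonoOn (whithamFactor C) (Ico 0 C) := by
    refine strictMonoOn_of_deriv_pos (convex_Ico 0 C) hcont fun p hp => ?_
    rw [interior_Ico] at hp
    rw [(hasDerivAt_whithamFactor hp.1 hp.2).deriv]
    have := ellipticB_pos hp.1 hp.2
    positivity
  calc 0 = whithamFactor C 0 := by simp [whithamFactor, ellipticB_zero hC]
    _ < whithamFactor C q := hmono ⟨le_rfl, hC⟩ ⟨hq0.le, hq⟩ hq0

theorem hasDerivAt_whithamSpeed (hq0 : 0 < q) (hq : q < C) :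
    HasDerivAt (whithamSpeed C)
      (ellipticK C q * whithamFactor C q / (6 * ellipticB C q ^ 2)) q := by
  have hC := hq0.trans hq
  have hK := hasDerivAt_ellipticK hC hq hq0.ne'
  have hB := hasDerivAt_ellipticB hC hq hq0.ne'
  have hid := hasDerivAt_id q
  have hB0 := (ellipticB_pos hq0 hq).ne'
  refine (((hid.const_add C).div_const 6).sub
    (((hid.mul (hid.const_sub C)).mul hK).div (hB.const_mul 3) (by positivity))).congr_deriv ?_
  have hCq := (sub_pos.2 hq).ne'
  simp only [id_eq, Pi.mul_apply, whithamFactor]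
  field_simp
  ring

theorem strictMonoOn_whithamSpeed : StrictMonoOn (whithamSpeed C) (Ioo 0 C) := by
  refine strictMonoOn_of_deriv_pos (convex_Ioo 0 C) (fun p hp =>
    (hasDerivAt_whithamSpeed hp.1 hp.2).continuousAt.continuousWithinAt) fun p hp => ?_
  rw [interior_Ioo] at hp
  rw [(hasDerivAt_whithamSpeed hp.1 hp.2).deriv]
  have hK := ellipticK_pos (hp.1.trans hp.2) hp.2
  have hB := ellipticB_pos hp.1 hp.2
  have hH := whithamFactor_pos hp.1 hp.2
  positivity

theorem sub_whithamSpeed (hq0 : 0 < q) (hq : q < C) :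
    3 / 2 * q - C / 2 - whithamSpeed C q = whithamFactor C q / (3 * ellipticB C q) := by
  have hB := (ellipticB_pos hq0 hq).ne'
  rw [whithamSpeed, whithamFactor]
  field_simp
  ring

theorem whithamSpeed_lt (hq0 : 0 < q) (hq : q < C) : whithamSpeed C q < 3 / 2 * q - C / 2 := by
  have hB := ellipticB_pos hq0 hq
  have hF := whithamFactor_pos hq0 hq
  exact sub_pos.1 (sub_whithamSpeed hq0 hq ▸ by positivity)

theorem tendsto_whithamSpeed (hC : 0 < C) :
    Tendsto (whithamSpeed C) (𝓝[<] C) (𝓝 (C / 3)) := by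
  have hid : Tendsto (fun q : ℝ => q) (𝓝[<] C) (𝓝 C) := nhdsWithin_le_nhds
  have h := ((hid.const_add C).div_const 6).sub ((hid.mul (tendsto_sub_mul_ellipticK hC)).div
    ((tendsto_ellipticB hC).const_mul 3) (by positivity))
  rw [show (C + C) / 6 - C * 0 / (3 * √C) = C / 3 by ring] at h
  refine h.congr fun q => ?_
  simp only [whithamSpeed, Pi.div_apply, mul_assoc]

theorem exists_whithamSpeed_eq (hC : 0 < C) (hξ : ξ ∈ Ioo (-C / 2) (C / 3)) :
    ∃ q ∈ Ioo 0 C, whithamSpeed C q = ξ := by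
  obtain ⟨hξ0, hξ1⟩ := hξ
  let q₀ := min (C / 2) ((ξ + C / 2) / 3)
  have hq₀0 : 0 < q₀ := lt_min (by linarith) (by linarith)
  have hq₀C : q₀ < C := (min_le_left _ _).trans_lt (by linarith)
  have hlow : whithamSpeed C q₀ ≤ ξ := by
    have hq₀ : q₀ ≤ (ξ + C / 2) / 3 := min_le_right _ _
    linarith [whithamSpeed_lt hq₀0 hq₀C]
  have hev : ∀ᶠ q in 𝓝[<] C, q ∈ Ioo 0 C := Ioo_mem_nhdsLT hC
  obtain ⟨q₁, hq₁, hhigh⟩ :=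
    (hev.and ((tendsto_whithamSpeed hC).eventually (lt_mem_nhds hξ1))).exists
  exact isPreconnected_Ioo.intermediate_value ⟨hq₀0, hq₀C⟩ hq₁ (fun p hp =>
    (hasDerivAt_whithamSpeed hp.1 hp.2).continuousAt.continuousWithinAt) ⟨hlow, hhigh.le⟩

theorem existsUnique_whithamSpeed_eq (hC : 0 < C) (hξ : ξ ∈ Ioo (-C / 2) (C / 3)) :
    ∃! q, q ∈ Ioo 0 C ∧ whithamSpeed C q = ξ := by
  obtain ⟨q, hq, hqξ⟩ := exists_whithamSpeed_eq hC hξ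
  exact ⟨q, ⟨hq, hqξ⟩, fun p hp => strictMonoOn_whithamSpeed.injOn hp.1 hq (hp.2.trans hqξ.symm)⟩

end WhithamSpeed

section QuadraticPeriods

variable {E : Type*} [NormedAddCommGroup E] [NormedSpace ℝ E] {C q : ℝ}

/-- The coefficient of `K` in the integrals of `(e₀ + e₁ λ + e₂ λ²) dλ / √(λ (λ + C) (λ + q))`
over the gap `[-q, 0]` and over the band `[-C, -q]`. -/
def coeffK (C q : ℝ) (e₀ e₁ e₂ : E) : E := e₀ - q • e₁ + (q * (C + 2 * q) / 3) • e₂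

/-- The coefficient of `B` in the same integrals, up to a sign over the band. -/
def coeffB (C q : ℝ) (e₁ e₂ : E) : E := e₁ - (2 / 3 * (C + q)) • e₂

/-- By Legendre's relation, a differential with vanishing gap period has a band period proportional
to its coefficient of `B`. -/
theorem riemann_bilinear (hq0 : 0 < q) (hq : q < C) {x y : E}
    (hgap : ellipticK C q • x + ellipticB C q • y = 0) :
    ellipticK C q • (ellipticK C (C - q) • x - ellipticB C (C - q) • y) = -(π / 2) • y := by
  rw [← legendre_relation hq0 hq, smul_sub, smul_comm, eq_neg_of_add_eq_zero_left hgap]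
  module

variable [CompleteSpace E]

theorem integral_inv_ellipticDelta_smul_quadratic (hC : 0 < C) (hq : q < C) (x₀ x₁ x₂ : E) :
    ∫ φ in (0 : ℝ)..π / 2, (ellipticDelta C q φ)⁻¹ •
        (x₀ + (q * sin φ ^ 2) • x₁ + (q * sin φ ^ 2) ^ 2 • x₂) =
      ellipticK C q • x₀ + (q * ellipticK C q - ellipticB C q) • x₁ +
        (q * (C + 2 * q) / 3 * ellipticK C q - 2 / 3 * (C + q) * ellipticB C q) • x₂ := by
  have hint (n : ℤ) (x : E) :
      IntervalIntegrable (fun φ => ellipticDelta C q φ ^ n • x) volume 0 (π / 2) :=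
    ((continuous_ellipticDelta_zpow hC hq n).smul continuous_const).intervalIntegrable _ _
  have hsplit (φ : ℝ) : (ellipticDelta C q φ)⁻¹ •
        (x₀ + (q * sin φ ^ 2) • x₁ + (q * sin φ ^ 2) ^ 2 • x₂)
      = ellipticDelta C q φ ^ (-1 : ℤ) • (x₀ + C • x₁ + C ^ 2 • x₂)
        + ellipticDelta C q φ ^ (1 : ℤ) • (-x₁ - (2 * C) • x₂)
        + ellipticDelta C q φ ^ (3 : ℤ) • x₂ := by
    have hD := (ellipticDelta_pos hC hq φ).ne'
    rw [show q * sin φ ^ 2 = C - ellipticDelta C q φ ^ 2 by rw [ellipticDelta_sq hC hq]; ring]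
    simp only [zpow_neg_one, zpow_ofNat]
    match_scalars <;> field_simp <;> ring
  have hE : ellipticMoment 1 C q = ellipticB C q + (C - q) * ellipticK C q := by
    rw [ellipticB, sub_add_cancel]
  have hE₃ : ellipticMoment 3 C q
      = (2 * (2 * C - q) * ellipticMoment 1 C q - C * (C - q) * ellipticK C q) / 3 := by
    have hrec := ellipticMoment_add_two hC hq 1
    norm_num at hrec
    rw [ellipticK]
    linarith
  simp only [hsplit]
  rw [integral_add ((hint _ _).add (hint _ _)) (hint _ _), integral_add (hint _ _) (hint _ _)]
  simp only [intervalIntegral.integral_smul_const]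
  change ellipticK C q • _ + ellipticMoment 1 C q • _ + ellipticMoment 3 C q • _ = _
  rw [hE₃, hE]
  module

theorem integral_gap (hC : 0 < C) (hq : q < C) (e₀ e₁ e₂ : E) :
    ∫ φ in (0 : ℝ)..π / 2, (ellipticDelta C q φ)⁻¹ •
        (e₀ - (q * sin φ ^ 2) • e₁ + (q * sin φ ^ 2) ^ 2 • e₂) =
      ellipticK C q • coeffK C q e₀ e₁ e₂ + ellipticB C q • coeffB C q e₁ e₂ := by
  simp only [sub_eq_add_neg _ ((_ : ℝ) • _), ← smul_neg]
  rw [integral_inv_ellipticDelta_smul_quadratic hC hq, coeffK, coeffB]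
  module

theorem integral_band (hC : 0 < C) (hq0 : 0 < q) (e₀ e₁ e₂ : E) :
    ∫ φ in (0 : ℝ)..π / 2, (ellipticDelta C (C - q) φ)⁻¹ •
        (e₀ - ellipticDelta C (C - q) φ ^ 2 • e₁ + (ellipticDelta C (C - q) φ ^ 2) ^ 2 • e₂) =
      ellipticK C (C - q) • coeffK C q e₀ e₁ e₂ - ellipticB C (C - q) • coeffB C q e₁ e₂ := by
  have hq' := sub_lt_self C hq0
  have hshift (φ : ℝ) :
      e₀ - ellipticDelta C (C - q) φ ^ 2 • e₁ + (ellipticDelta C (C - q) φ ^ 2) ^ 2 • e₂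
        = (e₀ - C • e₁ + C ^ 2 • e₂) + ((C - q) * sin φ ^ 2) • (e₁ - (2 * C) • e₂)
          + ((C - q) * sin φ ^ 2) ^ 2 • e₂ := by
    rw [ellipticDelta_sq hC hq']
    module
  simp only [hshift]
  rw [integral_inv_ellipticDelta_smul_quadratic hC hq', coeffK, coeffB]
  module

end QuadraticPeriods

section SquareRoots

variable {z w : ℂ}

theorem cpow_half_sq (z : ℂ) : (z ^ (1 / 2 : ℂ)) ^ 2 = z := by
  simp

theorem cpow_half_ofReal {x : ℝ} (hx : 0 ≤ x) : (x : ℂ) ^ (1 / 2 : ℂ) = √x := by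
  rw [sqrt_eq_rpow, Complex.ofReal_cpow hx]
  norm_num

theorem cpow_half_ofReal_of_nonpos {x : ℝ} (hx : x ≤ 0) :
    (x : ℂ) ^ (1 / 2 : ℂ) = Complex.I * √(-x) := by
  rw [Complex.ofReal_cpow_of_nonpos hx, ← Complex.ofReal_neg, cpow_half_ofReal (neg_nonneg.2 hx),
    show (π : ℂ) * Complex.I * (1 / 2) = π / 2 * Complex.I by ring, Complex.exp_pi_div_two_mul_I,
    mul_comm]

theorem re_cpow_half_mul_conj_pos (hz : z ≠ 0) (hw : w ≠ 0) (harg : |z.arg - w.arg| < π) :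
    0 < (z ^ (1 / 2 : ℂ) * starRingEnd ℂ (w ^ (1 / 2 : ℂ))).re := by
  rw [Complex.cpow_def_of_ne_zero hz, Complex.cpow_def_of_ne_zero hw, ← Complex.exp_conj,
    ← Complex.exp_add, Complex.exp_re]
  refine mul_pos (exp_pos _) (cos_pos_of_mem_Ioo ?_)
  have him : (Complex.log z * (1 / 2) + starRingEnd ℂ (Complex.log w * (1 / 2))).im
      = (z.arg - w.arg) / 2 := by
    simp only [Complex.add_im, Complex.conj_im, Complex.mul_im, Complex.log_im, Complex.log_re,
      one_div, Complex.inv_re, Complex.inv_im, Complex.re_ofNat, Complex.im_ofNat,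
      Complex.normSq_ofNat, neg_zero, zero_div, mul_zero]
    ring
  rw [him]
  constructor <;> linarith [abs_lt.1 harg]

theorem abs_arg_sub_arg_lt_pi (him : z.im = w.im) (hre : z.im = 0 → 0 < z.re * w.re) :
    |z.arg - w.arg| < π := by
  rw [abs_lt]
  rcases lt_trichotomy z.im 0 with h | h | h
  · have hz := Complex.arg_neg_iff.2 h
    have hw := Complex.arg_neg_iff.2 (him ▸ h)
    constructor <;> linarith [Complex.neg_pi_lt_arg z, Complex.neg_pi_lt_arg w]
  · rcases pos_and_pos_or_neg_and_neg_of_mul_pos (hre h) with ⟨hz, hw⟩ | ⟨hz, hw⟩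
    · rw [Complex.arg_eq_zero_iff.2 ⟨hz.le, h⟩, Complex.arg_eq_zero_iff.2 ⟨hw.le, him ▸ h⟩]
      simp [pi_pos]
    · rw [Complex.arg_eq_pi_iff.2 ⟨hz, h⟩, Complex.arg_eq_pi_iff.2 ⟨hw, him ▸ h⟩]
      simp [pi_pos]
  · have hz := Complex.arg_lt_pi_iff.2 (.inr h.ne')
    have hw := Complex.arg_lt_pi_iff.2 (.inr (him ▸ h).ne')
    constructor <;>
      linarith [Complex.arg_nonneg_iff.2 h.le, Complex.arg_nonneg_iff.2 (him ▸ h).le]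

theorem re_cpow_half_mul_conj_pos_of_notMem_segment {C q : ℝ} (hq : q < C) {l : ℂ}
    (hl : l ∉ segment ℝ (-C : ℂ) (-q)) :
    0 < ((l + C) ^ (1 / 2 : ℂ) * starRingEnd ℂ ((l + q) ^ (1 / 2 : ℂ))).re := by
  refine re_cpow_half_mul_conj_pos (fun h => hl ?_) (fun h => hl ?_)
    (abs_arg_sub_arg_lt_pi (by simp) fun him => ?_)
  · exact eq_neg_of_add_eq_zero_left h ▸ left_mem_segment ℝ _ _
  · exact eq_neg_of_add_eq_zero_left h ▸ right_mem_segment ℝ _ _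
  · obtain ⟨x, rfl⟩ : ∃ x : ℝ, (x : ℂ) = l :=
      ⟨l.re, Complex.ext rfl (by simpa using him.symm)⟩
    simp only [← Complex.ofReal_add, Complex.ofReal_re]
    by_contra! hcut
    have hCq := sub_pos.2 hq
    refine hl ⟨(-q - x) / (C - q), (x + C) / (C - q), div_nonneg (by nlinarith) hCq.le,
      div_nonneg (by nlinarith) hCq.le, by field_simp; ring, ?_⟩
    rw [Complex.real_smul, Complex.real_smul]
    norm_cast
    field_simp
    ring

end SquareRoots

section CutIntegrals

/-- The integrand is the derivative of
`φ + (log (1 + w e^{-2iφ}) - log (1 + w e^{2iφ})) / 2i`. -/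
theorem integral_poisson_half {w : ℂ} (hw : ‖w‖ < 1) :
    ∫ φ in (0 : ℝ)..π / 2, (1 - w ^ 2) /
      ((1 + w * Complex.exp (2 * φ * Complex.I)) * (1 + w * Complex.exp (-(2 * φ * Complex.I))))
      = (π / 2 : ℂ) := by
  have hslit (φ : ℝ) : 1 + w * Complex.exp (2 * φ * Complex.I) ∈ Complex.slitPlane := by
    refine Complex.mem_slitPlane_of_norm_lt_one ?_
    rwa [norm_mul, ← Complex.ofReal_ofNat, ← Complex.ofReal_mul, Complex.norm_exp_ofReal_mul_I,
      mul_one]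
  have hslit' (φ : ℝ) : 1 + w * Complex.exp (-(2 * φ * Complex.I)) ∈ Complex.slitPlane := by
    simpa using hslit (-φ)
  have hderiv (φ : ℝ) : HasDerivAt (fun φ : ℝ => (φ : ℂ) +
      (Complex.log (1 + w * Complex.exp (-(2 * φ * Complex.I)))
        - Complex.log (1 + w * Complex.exp (2 * φ * Complex.I))) / (2 * Complex.I))
      ((1 - w ^ 2) / ((1 + w * Complex.exp (2 * φ * Complex.I)) *
        (1 + w * Complex.exp (-(2 * φ * Complex.I))))) φ := by
    have harg : HasDerivAt (fun φ : ℝ => 2 * (φ : ℂ) * Complex.I) (2 * Complex.I) φ := by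
      simpa using ((Complex.ofRealCLM.hasDerivAt (x := φ)).const_mul 2).mul_const Complex.I
    have hplus := ((harg.cexp.const_mul w).const_add 1).clog_real (hslit φ)
    have hminus := ((harg.fun_neg.cexp.const_mul w).const_add 1).clog_real (hslit' φ)
    refine ((Complex.ofRealCLM.hasDerivAt (x := φ)).add
      ((hminus.sub hplus).div_const (2 * Complex.I))).congr_deriv ?_
    have h₁ := Complex.slitPlane_ne_zero (hslit φ)
    have h₂ := Complex.slitPlane_ne_zero (hslit' φ)
    have hexp : Complex.exp (2 * φ * Complex.I) * Complex.exp (-(2 * φ * Complex.I)) = 1 := by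
      rw [← Complex.exp_add, add_neg_cancel, Complex.exp_zero]
    simp only [Complex.ofRealCLM_apply, Complex.ofReal_one]
    field_simp
    linear_combination -w ^ 2 * hexp
  have hcont : Continuous fun φ : ℝ => (1 - w ^ 2) /
      ((1 + w * Complex.exp (2 * φ * Complex.I)) *
        (1 + w * Complex.exp (-(2 * φ * Complex.I)))) := by
    refine continuous_const.div (by fun_prop) fun φ => mul_ne_zero ?_ ?_
    · exact Complex.slitPlane_ne_zero (hslit φ)
    · exact Complex.slitPlane_ne_zero (hslit' φ)
  have hexp : Complex.exp (2 * (π / 2) * Complex.I) = Complex.exp (-(2 * (π / 2) * Complex.I)) := by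
    rw [mul_div_cancel₀ _ two_ne_zero, Complex.exp_neg, Complex.exp_pi_mul_I, inv_neg, inv_one]
  rw [integral_eq_sub_of_hasDerivAt (fun φ _ => hderiv φ) (hcont.intervalIntegrable _ _)]
  push_cast
  rw [hexp]
  simp

theorem add_exp_mul_add_exp_neg (u v : ℂ) (φ : ℝ) :
    (u + v + (u - v) * Complex.exp (2 * φ * Complex.I)) *
        (u + v + (u - v) * Complex.exp (-(2 * φ * Complex.I)))
      = 4 * (u ^ 2 * cos φ ^ 2 + v ^ 2 * sin φ ^ 2) := by
  have hexp : Complex.exp (2 * φ * Complex.I) * Complex.exp (-(2 * φ * Complex.I)) = 1 := by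
    rw [← Complex.exp_add, add_neg_cancel, Complex.exp_zero]
  have hcos : Complex.exp (2 * φ * Complex.I) + Complex.exp (-(2 * φ * Complex.I))
      = 2 * cos φ ^ 2 - 2 * sin φ ^ 2 := by
    have htwo := Complex.two_cos (2 * φ)
    rw [neg_mul, Complex.cos_two_mul'] at htwo
    push_cast
    linear_combination -htwo
  have hpyth : (sin φ ^ 2 + cos φ ^ 2 : ℂ) = 1 := by exact_mod_cast sin_sq_add_cos_sq φ
  linear_combination
    (u - v) ^ 2 * hexp + (u ^ 2 - v ^ 2) * hcos - (2 * u ^ 2 + 2 * v ^ 2) * hpyth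

theorem integral_inv_sq_mul_cos_sq_add_sq_mul_sin_sq {u v : ℂ}
    (huv : 0 < (u * starRingEnd ℂ v).re) :
    ∫ φ in (0 : ℝ)..π / 2, (u ^ 2 * cos φ ^ 2 + v ^ 2 * sin φ ^ 2 : ℂ)⁻¹ = π / (2 * (u * v)) := by
  have hu : u ≠ 0 := by rintro rfl; simp at huv
  have hv : v ≠ 0 := by rintro rfl; simp at huv
  have hnorm : ‖u - v‖ < ‖u + v‖ := by
    rw [← sq_lt_sq₀ (norm_nonneg _) (norm_nonneg _), Complex.sq_norm, Complex.sq_norm,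
      Complex.normSq_sub, Complex.normSq_add]
    linarith
  have hsum : u + v ≠ 0 := norm_pos_iff.1 ((norm_nonneg _).trans_lt hnorm)
  have hw : ‖(u - v) / (u + v)‖ < 1 := by
    rwa [norm_div, div_lt_one (norm_pos_iff.2 hsum)]
  have hintegrand (φ : ℝ) : (1 - ((u - v) / (u + v)) ^ 2) /
      ((1 + (u - v) / (u + v) * Complex.exp (2 * φ * Complex.I)) *
        (1 + (u - v) / (u + v) * Complex.exp (-(2 * φ * Complex.I))))
      = u * v * (u ^ 2 * cos φ ^ 2 + v ^ 2 * sin φ ^ 2 : ℂ)⁻¹ := by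
    have hfactor : (u ^ 2 * cos φ ^ 2 + v ^ 2 * sin φ ^ 2 : ℂ)
        = (u + v + (u - v) * Complex.exp (2 * φ * Complex.I)) *
          (u + v + (u - v) * Complex.exp (-(2 * φ * Complex.I))) / 4 := by
      rw [add_exp_mul_add_exp_neg]
      ring
    rw [hfactor]
    field_simp
    ring
  have h := integral_poisson_half hw
  simp only [hintegrand, intervalIntegral.integral_const_mul] at h
  rw [eq_div_iff (by simp [hu, hv])]
  linear_combination 2 * h

theorem circleIntegral_mul_intervalIntegral_inv_sub {g : ℂ → ℂ} {z₀ : ℂ} {r a b : ℝ} {γ : ℝ → ℂ}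
    (hg : DiffContOnCl ℂ g (Metric.ball z₀ r)) (hγ : Continuous γ)
    (hmem : ∀ θ, γ θ ∈ Metric.ball z₀ r) :
    (∮ l in C(z₀, r), g l * ∫ θ in a..b, (l - γ θ)⁻¹)
      = 2 * π * Complex.I * ∫ θ in a..b, g (γ θ) := by
  have hr : 0 < r := Metric.pos_of_mem_ball (hmem 0)
  have hne (t θ : ℝ) : circleMap z₀ r t - γ θ ≠ 0 := fun h0 => by
    have hsphere := circleMap_mem_sphere z₀ hr.le t
    exact (sub_eq_zero.1 h0 ▸ hmem θ : _ ∈ Metric.ball z₀ r).ne hsphere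
  have hgcirc : Continuous fun t => g (circleMap z₀ r t) :=
    hg.continuousOn_ball.comp_continuous (continuous_circleMap _ _)
      fun t => circleMap_mem_closedBall _ hr.le t
  let F (t θ : ℝ) : ℂ :=
    deriv (circleMap z₀ r) t • ((circleMap z₀ r t - γ θ)⁻¹ • g (circleMap z₀ r t))
  have hF : Continuous (Function.uncurry F) := by
    have hderiv : Continuous (deriv (circleMap z₀ r)) := by
      simp only [funext (deriv_circleMap z₀ r)]
      fun_prop
    have hinv : Continuous fun p : ℝ × ℝ => (circleMap z₀ r p.1 - γ p.2)⁻¹ :=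
      Continuous.inv₀ (by fun_prop) fun p => hne p.1 p.2
    exact (hderiv.comp continuous_fst).smul (hinv.smul (hgcirc.comp continuous_fst))
  have hint : IntegrableOn (Function.uncurry F) (uIoc 0 (2 * π) ×ˢ uIoc a b)
      (volume.prod volume) :=
    (hF.continuousOn.integrableOn_compact (isCompact_uIcc.prod isCompact_uIcc)).mono_set
      (prod_mono uIoc_subset_uIcc uIoc_subset_uIcc)
  calc (∮ l in C(z₀, r), g l * ∫ θ in a..b, (l - γ θ)⁻¹)
      = ∫ t in (0 : ℝ)..2 * π, ∫ θ in a..b, F t θ := by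
        refine integral_congr fun t _ => ?_
        simp only [F, smul_eq_mul, intervalIntegral.integral_const_mul,
          intervalIntegral.integral_mul_const]
        ring
    _ = ∫ θ in a..b, ∫ t in (0 : ℝ)..2 * π, F t θ :=
        intervalIntegral_intervalIntegral_swap (F := F) hint
    _ = ∫ θ in a..b, (2 * π * Complex.I) • g (γ θ) :=
        integral_congr fun θ _ => hg.circleIntegral_sub_inv_smul (hmem θ)
    _ = 2 * π * Complex.I * ∫ θ in a..b, g (γ θ) := by
        simp only [smul_eq_mul, intervalIntegral.integral_const_mul]

/-- Off the cut `[-C, -q]`, the inverse root is an average of Cauchy kernels with poles on the cut,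
parametrised by `-(C cos² φ + q sin² φ)`. -/
theorem inv_cpow_half_mul_cpow_half_eq_integral {C q : ℝ} (hq : q < C) {l : ℂ}
    (hl : l ∉ segment ℝ (-C : ℂ) (-q)) :
    ((l + C) ^ (1 / 2 : ℂ) * (l + q) ^ (1 / 2 : ℂ))⁻¹ =
      2 / π * ∫ φ in (0 : ℝ)..π / 2, (l - -(C * cos φ ^ 2 + q * sin φ ^ 2))⁻¹ := by
  have hpyth (φ : ℝ) : (sin φ ^ 2 + cos φ ^ 2 : ℂ) = 1 := by
    exact_mod_cast sin_sq_add_cos_sq φ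
  have hden (φ : ℝ) : l - -(C * cos φ ^ 2 + q * sin φ ^ 2 : ℂ)
      = (l + C) * cos φ ^ 2 + (l + q) * sin φ ^ 2 := by
    linear_combination -l * hpyth φ
  have h := integral_inv_sq_mul_cos_sq_add_sq_mul_sin_sq
    (re_cpow_half_mul_conj_pos_of_notMem_segment hq hl)
  simp only [cpow_half_sq] at h
  simp only [hden, h]
  have hpi : (π : ℂ) ≠ 0 := Complex.ofReal_ne_zero.2 pi_ne_zero
  field_simp

theorem circleIntegral_eq_integral_cut {C q r : ℝ} {z₀ : ℂ} {g : ℂ → ℂ} (hq : q < C)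
    (hCmem : (-C : ℂ) ∈ Metric.ball z₀ r) (hqmem : (-q : ℂ) ∈ Metric.ball z₀ r)
    (hg : DiffContOnCl ℂ g (Metric.ball z₀ r)) :
    (∮ l in C(z₀, r), g l * ((l + C) ^ (1 / 2 : ℂ) * (l + q) ^ (1 / 2 : ℂ))⁻¹)
      = 4 * Complex.I * ∫ φ in (0 : ℝ)..π / 2, g (-(C * cos φ ^ 2 + q * sin φ ^ 2)) := by
  have hr : 0 < r := Metric.pos_of_mem_ball hCmem
  have hsegment := (convex_ball z₀ r).segment_subset hCmem hqmem
  have hcut (φ : ℝ) : (-(C * cos φ ^ 2 + q * sin φ ^ 2) : ℂ) ∈ Metric.ball z₀ r := by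
    refine hsegment ⟨cos φ ^ 2, sin φ ^ 2, sq_nonneg _, sq_nonneg _, cos_sq_add_sin_sq φ, ?_⟩
    simp only [Complex.real_smul]
    push_cast
    ring
  have hroot : EqOn
      (fun l => g l * ((l + C) ^ (1 / 2 : ℂ) * (l + q) ^ (1 / 2 : ℂ))⁻¹)
      (fun l => 2 / π * (g l * ∫ φ in (0 : ℝ)..π / 2,
        (l - -(C * cos φ ^ 2 + q * sin φ ^ 2))⁻¹)) (Metric.sphere z₀ r) := fun l hl => by
    have hl' : l ∉ segment ℝ (-C : ℂ) (-q) := fun h =>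
      (Metric.mem_ball.1 (hsegment h)).ne (Metric.mem_sphere.1 hl)
    simp only [inv_cpow_half_mul_cpow_half_eq_integral hq hl']
    ring
  rw [circleIntegral.integral_congr hr.le hroot, circleIntegral.integral_const_mul,
    circleIntegral_mul_intervalIntegral_inv_sub hg (by fun_prop) hcut]
  have hpi : (π : ℂ) ≠ 0 := Complex.ofReal_ne_zero.2 pi_ne_zero
  field_simp
  ring

end CutIntegrals

section Periods

variable {c α : ℝ}

/-- The coefficient of the differential `(e₀ + e₁ λ + e₂ λ²) dλ / y`, a general linear combination
of the differentials that enter `hOf`, `dOmega1` and `dOmega3`. -/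
def quadDifferential (e₀ e₁ e₂ l y : ℂ) : ℂ := (e₀ + e₁ * l + e₂ * l ^ 2) / y

theorem R_neg_mul_sin_sq (hα : 0 ≤ α) (hαc : α < c) {φ : ℝ} (hsin : 0 ≤ sin φ) (hcos : 0 ≤ cos φ) :
    R c α ((-(α ^ 2 * sin φ ^ 2) : ℝ) : ℂ) =
      Complex.I * ((α ^ 2 * (sin φ * cos φ) * ellipticDelta (c ^ 2) (α ^ 2) φ : ℝ) : ℂ) := by
  have hD : 0 ≤ c ^ 2 - α ^ 2 * sin φ ^ 2 :=
    (sub_mul_sin_sq_pos (sq_pos_of_pos (hα.trans_lt hαc)) (by gcongr) φ).le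
  have hneg : -((-(α ^ 2 * sin φ ^ 2) : ℝ) : ℂ) = (((α * sin φ) ^ 2 : ℝ) : ℂ) := by
    push_cast; ring
  have hc : ((-(α ^ 2 * sin φ ^ 2) : ℝ) : ℂ) + (c : ℂ) ^ 2 =
      ((c ^ 2 - α ^ 2 * sin φ ^ 2 : ℝ) : ℂ) := by push_cast; ring
  have hα' : ((-(α ^ 2 * sin φ ^ 2) : ℝ) : ℂ) + (α : ℂ) ^ 2 = (((α * cos φ) ^ 2 : ℝ) : ℂ) := by
    rw [mul_pow, cos_sq']; push_cast; ring
  rw [R, hneg, hc, hα', cpow_half_ofReal (sq_nonneg _), cpow_half_ofReal hD,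
    cpow_half_ofReal (sq_nonneg _), sqrt_sq (by positivity), sqrt_sq (by positivity), ellipticDelta]
  push_cast
  ring

theorem sin_cos_pos_of_mem_Ioo {φ : ℝ} (hφ : φ ∈ Ioo 0 (π / 2)) : 0 < sin φ ∧ 0 < cos φ :=
  ⟨sin_pos_of_pos_of_lt_pi hφ.1 (by linarith [hφ.2, pi_pos]),
    cos_pos_of_mem_Ioo ⟨by linarith [hφ.1, pi_pos], hφ.2⟩⟩

theorem integral_neg_mul_sin_sq_subst {E : Type*} [NormedAddCommGroup E] [NormedSpace ℝ E] {q : ℝ}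
    (hq : 0 ≤ q) (f : ℝ → E) :
    ∫ φ in (0 : ℝ)..π / 2, (-(2 * q * (sin φ * cos φ))) • f (-(q * sin φ ^ 2)) =
      ∫ l in (0 : ℝ)..-q, f l := by
  have hderiv (φ : ℝ) :
      HasDerivAt (fun φ => -(q * sin φ ^ 2)) (-(2 * q * (sin φ * cos φ))) φ := by
    refine ((((hasDerivAt_sin φ).fun_pow 2).const_mul q).fun_neg).congr_deriv ?_
    push_cast; ring
  have hsubst := integral_deriv_smul_comp_of_deriv_nonpos (a := 0) (b := π / 2) (g := f)
    (f := fun φ => -(q * sin φ ^ 2)) (by fun_prop) (fun φ _ => hderiv φ) fun φ hφ => by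
      rw [min_eq_left (by positivity), max_eq_right (by positivity)] at hφ
      obtain ⟨hsin, hcos⟩ := sin_cos_pos_of_mem_Ioo hφ
      rw [Left.neg_nonpos_iff]
      positivity
  simpa using hsubst

theorem aPeriod_quadDifferential (hα : 0 < α) (hαc : α < c) (e₀ e₁ e₂ : ℂ) :
    aPeriod c α (quadDifferential e₀ e₁ e₂) =
      4 * Complex.I * (ellipticK (c ^ 2) (α ^ 2) • coeffK (c ^ 2) (α ^ 2) e₀ e₁ e₂ +
        ellipticB (c ^ 2) (α ^ 2) • coeffB (c ^ 2) (α ^ 2) e₁ e₂) := by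
  have hC : 0 < c ^ 2 := sq_pos_of_pos (hα.trans hαc)
  have hq : α ^ 2 < c ^ 2 := by gcongr
  have hsheet : ∫ l in (0 : ℝ)..(-α ^ 2), quadDifferential e₀ e₁ e₂ l (R c α l) =
      2 * Complex.I * ∫ φ in (0 : ℝ)..π / 2, (ellipticDelta (c ^ 2) (α ^ 2) φ)⁻¹ •
        (e₀ - (α ^ 2 * sin φ ^ 2) • e₁ + (α ^ 2 * sin φ ^ 2) ^ 2 • e₂) := by
    rw [← integral_neg_mul_sin_sq_subst (sq_nonneg α), ← intervalIntegral.integral_const_mul]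
    refine integral_congr_Ioo_of_le (by positivity) fun φ hφ => ?_
    obtain ⟨hsin, hcos⟩ := sin_cos_pos_of_mem_Ioo hφ
    have hden : ((α ^ 2 * (sin φ * cos φ) : ℝ) : ℂ) ≠ 0 := by
      rw [Complex.ofReal_ne_zero]; positivity
    have hD : (ellipticDelta (c ^ 2) (α ^ 2) φ : ℂ) ≠ 0 :=
      Complex.ofReal_ne_zero.2 (ellipticDelta_pos hC hq φ).ne'
    simp only [quadDifferential, R_neg_mul_sin_sq hα.le hαc hsin.le hcos.le, Complex.real_smul,
      mul_assoc (2 : ℝ), Complex.ofReal_mul _ (ellipticDelta _ _ _)]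
    generalize α ^ 2 * (sin φ * cos φ) = s at *
    push_cast
    field_simp
    rw [Complex.I_sq]
    ring
  rw [← integral_gap hC hq, aPeriod]
  simp only [quadDifferential, div_neg, intervalIntegral.integral_neg] at hsheet ⊢
  rw [← intervalIntegral.integral_symm, hsheet]
  ring

theorem differentiableOn_inv_I_mul_cpow_half_neg :
    DifferentiableOn ℂ (fun l : ℂ => (Complex.I * (-l) ^ (1 / 2 : ℂ))⁻¹) {l | l.re < 0} := by
  intro l (hl : l.re < 0)
  have hslit : -l ∈ Complex.slitPlane := Or.inl (by simpa using hl)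
  have hpow : (-l) ^ (1 / 2 : ℂ) ≠ 0 := by
    rw [Ne, Complex.cpow_eq_zero_iff]
    exact fun h => Complex.slitPlane_ne_zero hslit h.1
  exact (((differentiableAt_id.neg.cpow (differentiableAt_const _) hslit).const_mul
    Complex.I).fun_inv (mul_ne_zero Complex.I_ne_zero hpow)).differentiableWithinAt

theorem closedBall_ofReal_subset_re_neg {x r : ℝ} (h : x + r < 0) :
    Metric.closedBall (x : ℂ) r ⊆ {l | l.re < 0} := by
  intro l hl
  rw [Metric.mem_closedBall, Complex.dist_eq] at hl
  have hre := (Complex.re_le_norm _).trans hl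
  rw [Complex.sub_re, Complex.ofReal_re] at hre
  exact (sub_le_iff_le_add'.1 hre).trans_lt h

theorem bPeriod_div (hα : 0 < α) (hαc : α < c) {p : ℂ → ℂ} (hp : Differentiable ℂ p) :
    bPeriod c α (fun l y => p l / y) = -4 * ∫ φ in (0 : ℝ)..π / 2,
      (ellipticDelta (c ^ 2) (c ^ 2 - α ^ 2) φ)⁻¹ •
        p (-(ellipticDelta (c ^ 2) (c ^ 2 - α ^ 2) φ ^ 2 : ℝ)) := by
  have hC : 0 < c ^ 2 := sq_pos_of_pos (hα.trans hαc)
  have hq0 : 0 < α ^ 2 := sq_pos_of_pos hα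
  have hq : α ^ 2 < c ^ 2 := by gcongr
  have hcenter : -((c : ℂ) ^ 2 + (α : ℂ) ^ 2) / 2 = ((-(c ^ 2 + α ^ 2) / 2 : ℝ) : ℂ) := by
    push_cast; ring
  have hmem (x : ℝ) (hx : |-x - -(c ^ 2 + α ^ 2) / 2| < c ^ 2 / 2) :
      (-x : ℂ) ∈ Metric.ball ((-(c ^ 2 + α ^ 2) / 2 : ℝ) : ℂ) (c ^ 2 / 2) := by
    rwa [Metric.mem_ball, ← Complex.ofReal_neg, Complex.isometry_ofReal.dist_eq, Real.dist_eq]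
  have hcollapse := circleIntegral_eq_integral_cut hq
    (hmem _ (by rw [abs_lt]; constructor <;> linarith))
    (hmem _ (by rw [abs_lt]; constructor <;> linarith))
    (((hp.differentiableOn.fun_mul differentiableOn_inv_I_mul_cpow_half_neg).mono
      (closedBall_ofReal_subset_re_neg (by linarith))).diffContOnCl_ball Subset.rfl)
  have hR (l : ℂ) : p l / R c α l = p l * (Complex.I * (-l) ^ (1 / 2 : ℂ))⁻¹ *
      ((l + (c ^ 2 : ℝ)) ^ (1 / 2 : ℂ) * (l + (α ^ 2 : ℝ)) ^ (1 / 2 : ℂ))⁻¹ := by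
    simp only [R, div_eq_mul_inv, mul_inv, Complex.ofReal_pow, mul_assoc]
  have hcut (φ : ℝ) : -(((c ^ 2 : ℝ) : ℂ) * cos φ ^ 2 + ((α ^ 2 : ℝ) : ℂ) * sin φ ^ 2) =
      -((ellipticDelta (c ^ 2) (c ^ 2 - α ^ 2) φ ^ 2 : ℝ) : ℂ) := by
    rw [ellipticDelta_sq hC (sub_lt_self _ hq0), sin_sq]
    push_cast [Complex.sin_sq]
    ring
  simp only [bPeriod, hcenter, hR, hcollapse, hcut, neg_neg, cpow_half_ofReal (sq_nonneg _),
    sqrt_sq (ellipticDelta_pos hC (sub_lt_self _ hq0) _).le]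
  rw [← intervalIntegral.integral_const_mul, ← intervalIntegral.integral_const_mul,
    ← intervalIntegral.integral_neg]
  congr 1 with φ
  rw [mul_inv, Complex.inv_I, Complex.real_smul, Complex.ofReal_inv]
  linear_combination 4 * (ellipticDelta (c ^ 2) (c ^ 2 - α ^ 2) φ : ℂ)⁻¹ *
    p (-(ellipticDelta (c ^ 2) (c ^ 2 - α ^ 2) φ ^ 2 : ℝ)) * Complex.I_sq

theorem bPeriod_quadDifferential (hα : 0 < α) (hαc : α < c) (e₀ e₁ e₂ : ℂ) :
    bPeriod c α (quadDifferential e₀ e₁ e₂) =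
      -4 * (ellipticK (c ^ 2) (c ^ 2 - α ^ 2) • coeffK (c ^ 2) (α ^ 2) e₀ e₁ e₂ -
        ellipticB (c ^ 2) (c ^ 2 - α ^ 2) • coeffB (c ^ 2) (α ^ 2) e₁ e₂) := by
  rw [← integral_band (sq_pos_of_pos (hα.trans hαc)) (sq_pos_of_pos hα)]
  refine (bPeriod_div hα hαc (p := fun l => e₀ + e₁ * l + e₂ * l ^ 2) (by fun_prop)).trans ?_
  congr 3 with φ
  simp only [Complex.real_smul]
  push_cast
  ring

end Periods

section Differentials

variable {c α : ℝ}

theorem bPeriod_quadDifferential_of_aPeriod_eq_zero (hα : 0 < α) (hαc : α < c) {e₀ e₁ e₂ : ℂ}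
    (ha : aPeriod c α (quadDifferential e₀ e₁ e₂) = 0) :
    bPeriod c α (quadDifferential e₀ e₁ e₂) =
      (2 * π / ellipticK (c ^ 2) (α ^ 2)) • coeffB (c ^ 2) (α ^ 2) e₁ e₂ := by
  have hq : α ^ 2 < c ^ 2 := by gcongr
  have hK : (ellipticK (c ^ 2) (α ^ 2) : ℂ) ≠ 0 :=
    Complex.ofReal_ne_zero.2 (ellipticK_pos (sq_pos_of_pos (hα.trans hαc)) hq).ne'
  rw [aPeriod_quadDifferential hα hαc, mul_eq_zero_iff_left (by simp)] at ha
  have hbilinear := riemann_bilinear (sq_pos_of_pos hα) hq ha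
  rw [bPeriod_quadDifferential hα hαc]
  simp only [Complex.real_smul] at hbilinear ⊢
  push_cast at hbilinear ⊢
  field_simp
  linear_combination -4 * hbilinear

theorem hOf_eq (hα : 0 < α) (hαc : α < c) :
    hOf c α = (ellipticB (c ^ 2) (α ^ 2) / ellipticK (c ^ 2) (α ^ 2) - α ^ 2 : ℝ) := by
  have hK : (ellipticK (c ^ 2) (α ^ 2) : ℂ) ≠ 0 :=
    Complex.ofReal_ne_zero.2 (ellipticK_pos (sq_pos_of_pos (hα.trans hαc)) (by gcongr)).ne'
  have hnum : (fun l y : ℂ => l / y) = quadDifferential 0 1 0 := by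
    funext l y
    rw [quadDifferential]; ring
  have hden : (fun _ y : ℂ => 1 / y) = quadDifferential 1 0 0 := by
    funext l y
    rw [quadDifferential]; ring
  rw [hOf, hnum, hden, aPeriod_quadDifferential hα hαc, aPeriod_quadDifferential hα hαc]
  simp only [coeffK, coeffB, Complex.real_smul, mul_zero, mul_one, sub_zero, add_zero, zero_sub]
  push_cast
  field_simp
  ring

theorem dOmega1_eq_quadDifferential :
    dOmega1 c α = quadDifferential (-(Complex.I / 2 * hOf c α)) (Complex.I / 2) 0 := by
  funext l y
  rw [dOmega1, quadDifferential]
  ring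

theorem aPeriod_dOmega1 (hα : 0 < α) (hαc : α < c) : aPeriod c α (dOmega1 c α) = 0 := by
  have hK : (ellipticK (c ^ 2) (α ^ 2) : ℂ) ≠ 0 :=
    Complex.ofReal_ne_zero.2 (ellipticK_pos (sq_pos_of_pos (hα.trans hαc)) (by gcongr)).ne'
  rw [dOmega1_eq_quadDifferential, aPeriod_quadDifferential hα hαc, hOf_eq hα hαc]
  simp only [coeffK, coeffB, Complex.real_smul, mul_zero, sub_zero, add_zero]
  push_cast
  field_simp
  ring

theorem bPeriod_dOmega1 (hα : 0 < α) (hαc : α < c) :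
    bPeriod c α (dOmega1 c α) = Complex.I * (π / ellipticK (c ^ 2) (α ^ 2) : ℝ) := by
  have ha := aPeriod_dOmega1 hα hαc
  rw [dOmega1_eq_quadDifferential] at ha ⊢
  rw [bPeriod_quadDifferential_of_aPeriod_eq_zero hα hαc ha, coeffB, smul_zero, sub_zero,
    Complex.real_smul]
  push_cast
  ring

theorem dOmega3Form_eq_quadDifferential (ν : ℝ × ℝ) :
    dOmega3Form ν = quadDifferential (-(3 * Complex.I / 2) * (ν.1 * ν.2 : ℝ))
      (3 * Complex.I / 2 * (ν.1 + ν.2 : ℝ)) (-(3 * Complex.I / 2)) := by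
  funext l y
  rw [dOmega3Form, quadDifferential]
  push_cast
  ring

theorem aPeriod_dOmega3Form (hα : 0 < α) (hαc : α < c) (ν : ℝ × ℝ) :
    aPeriod c α (dOmega3Form ν) =
      (6 * (ellipticK (c ^ 2) (α ^ 2) • coeffK (c ^ 2) (α ^ 2) (ν.1 * ν.2) (-(ν.1 + ν.2)) 1 +
        ellipticB (c ^ 2) (α ^ 2) • coeffB (c ^ 2) (α ^ 2) (-(ν.1 + ν.2)) 1) : ℝ) := by
  rw [dOmega3Form_eq_quadDifferential, aPeriod_quadDifferential hα hαc]
  simp only [coeffK, coeffB, Complex.real_smul, smul_eq_mul]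
  push_cast
  ring_nf
  rw [Complex.I_sq]
  ring

theorem bPeriod_dOmega3Form (hα : 0 < α) (hαc : α < c) {ν : ℝ × ℝ} (hν : IsZeroPair c α ν) :
    bPeriod c α (dOmega3Form ν) =
      Complex.I * ((c ^ 2 + α ^ 2) / 2 * (π / ellipticK (c ^ 2) (α ^ 2)) : ℝ) := by
  obtain ⟨hsum, ha⟩ := hν
  have hsum' : ν.1 + ν.2 = -(c ^ 2 + α ^ 2) / 2 := by linarith
  rw [dOmega3Form_eq_quadDifferential] at ha ⊢
  rw [bPeriod_quadDifferential_of_aPeriod_eq_zero hα hαc ha, coeffB, hsum']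
  simp only [Complex.real_smul]
  push_cast
  ring

theorem four_mul_le_sq_of_gap_eq_zero {C q σ p : ℝ} (hC : 0 < C) (hq : q < C)
    (hgap : ellipticK C q • coeffK C q p (-σ) 1 + ellipticB C q • coeffB C q (-σ) 1 = 0) :
    4 * p ≤ σ ^ 2 := by
  have hsquare : 0 ≤ ∫ φ in (0 : ℝ)..π / 2, (ellipticDelta C q φ)⁻¹ •
      (σ ^ 2 / 4 - (q * sin φ ^ 2) • -σ + (q * sin φ ^ 2) ^ 2 • (1 : ℝ)) := by
    refine intervalIntegral.integral_nonneg (by positivity) fun φ _ => ?_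
    refine smul_nonneg (inv_nonneg.2 (ellipticDelta_pos hC hq φ).le) ?_
    simp only [smul_eq_mul]
    nlinarith [sq_nonneg (q * sin φ ^ 2 + σ / 2)]
  rw [integral_gap hC hq] at hsquare
  refine le_of_mul_le_mul_left ?_ (ellipticK_pos hC hq)
  simp only [coeffK, smul_eq_mul] at hgap hsquare
  linarith

theorem exists_isZeroPair (hα : 0 < α) (hαc : α < c) : ∃ ν : ℝ × ℝ, IsZeroPair c α ν := by
  have hC : 0 < c ^ 2 := sq_pos_of_pos (hα.trans hαc)
  have hq : α ^ 2 < c ^ 2 := by gcongr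
  have hK := (ellipticK_pos hC hq).ne'
  obtain ⟨σ, hσ⟩ : ∃ σ, σ = -(c ^ 2 + α ^ 2) / 2 := ⟨_, rfl⟩
  obtain ⟨p, hp⟩ : ∃ p, ellipticK (c ^ 2) (α ^ 2) • coeffK (c ^ 2) (α ^ 2) p (-σ) 1 +
      ellipticB (c ^ 2) (α ^ 2) • coeffB (c ^ 2) (α ^ 2) (-σ) 1 = 0 := by
    refine ⟨-(coeffK (c ^ 2) (α ^ 2) 0 (-σ) 1 + ellipticB (c ^ 2) (α ^ 2) /
      ellipticK (c ^ 2) (α ^ 2) * coeffB (c ^ 2) (α ^ 2) (-σ) 1), ?_⟩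
    simp only [coeffK, smul_eq_mul]
    field_simp
    ring
  have hdisc : 0 ≤ σ ^ 2 / 4 - p := by linarith [four_mul_le_sq_of_gap_eq_zero hC hq hp]
  have hprod : (σ / 2 + √(σ ^ 2 / 4 - p)) * (σ / 2 - √(σ ^ 2 / 4 - p)) = p := by
    linear_combination -sq_sqrt hdisc
  refine ⟨(σ / 2 + √(σ ^ 2 / 4 - p), σ / 2 - √(σ ^ 2 / 4 - p)), by dsimp only; linarith, ?_⟩
  rw [aPeriod_dOmega3Form hα hαc]
  dsimp only
  rw [hprod, add_add_sub_cancel, add_halves, hp, mul_zero, Complex.ofReal_zero]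

end Differentials

section BandEdge

variable {c α ξ : ℝ}

theorem integral_mul_sin_subst {E : Type*} [NormedAddCommGroup E] [NormedSpace ℝ E] {x y : ℝ}
    (hα : 0 ≤ α) (hx : x ∈ Icc (-(π / 2)) (π / 2)) (hy : y ∈ Icc (-(π / 2)) (π / 2)) (f : ℝ → E) :
    ∫ φ in x..y, (α * cos φ) • f (α * sin φ) = ∫ s in (α * sin x)..(α * sin y), f s :=
  integral_deriv_smul_comp_of_deriv_nonneg (f := fun φ => α * sin φ) (by fun_prop)
    (fun φ _ => (hasDerivAt_sin φ).const_mul α) fun _ hφ => mul_nonneg hα <|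
      cos_nonneg_of_mem_Icc ⟨(le_min hx.1 hy.1).trans hφ.1.le, hφ.2.le.trans (max_le hx.2 hy.2)⟩

theorem integral_inv_sqrt_gap (hα : 0 < α) (hαc : α < c) :
    ∫ s in (-α)..α, (√((c ^ 2 - s ^ 2) * (α ^ 2 - s ^ 2)))⁻¹ =
      2 * ellipticK (c ^ 2) (α ^ 2) := by
  have hC : 0 < c ^ 2 := sq_pos_of_pos (hα.trans hαc)
  have hq : α ^ 2 < c ^ 2 := by gcongr
  have hπ : -(π / 2) ≤ π / 2 := by linarith [pi_pos]
  have hcont := continuous_ellipticDelta_zpow hC hq (-1)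
  have heven : ∫ φ in (-(π / 2))..0, ellipticDelta (c ^ 2) (α ^ 2) φ ^ (-1 : ℤ) =
      ∫ φ in 0..(π / 2), ellipticDelta (c ^ 2) (α ^ 2) φ ^ (-1 : ℤ) := by
    have hreflect := intervalIntegral.integral_comp_neg (a := 0) (b := π / 2)
      fun φ => ellipticDelta (c ^ 2) (α ^ 2) φ ^ (-1 : ℤ)
    simpa only [ellipticDelta, sin_neg, neg_sq, neg_zero] using hreflect.symm
  have hfull : ∫ φ in (-(π / 2))..(π / 2), ellipticDelta (c ^ 2) (α ^ 2) φ ^ (-1 : ℤ) =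
      2 * ellipticK (c ^ 2) (α ^ 2) := by
    rw [← integral_add_adjacent_intervals (hcont.intervalIntegrable _ 0)
      (hcont.intervalIntegrable 0 _), heven, two_mul]
    rfl
  have hsubst := integral_mul_sin_subst hα.le (left_mem_Icc.2 hπ) (right_mem_Icc.2 hπ)
    fun s => (√((c ^ 2 - s ^ 2) * (α ^ 2 - s ^ 2)))⁻¹
  simp only [sin_neg, sin_pi_div_two, mul_one, mul_neg] at hsubst
  rw [← hsubst, ← hfull]
  refine integral_congr_Ioo_of_le hπ fun φ hφ => ?_
  have hcos := cos_pos_of_mem_Ioo hφ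
  have hfactor : (c ^ 2 - (α * sin φ) ^ 2) * (α ^ 2 - (α * sin φ) ^ 2) =
      (ellipticDelta (c ^ 2) (α ^ 2) φ * (α * cos φ)) ^ 2 := by
    rw [mul_pow (ellipticDelta _ _ _), ellipticDelta_sq hC hq, mul_pow α (cos φ), cos_sq']
    ring
  have hD := ellipticDelta_pos hC hq φ
  rw [hfactor, sqrt_sq (by positivity), zpow_neg_one, smul_eq_mul]
  field_simp

theorem coeffK_mul_add (C q κ : ℝ) : coeffK C q (κ * q) (κ + q) 1 = q * (C - q) / 3 := by
  simp only [coeffK, smul_eq_mul]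
  ring

theorem integral_zero_bandEdge (hα : 0 < α) (hαc : α < c) (κ : ℝ) :
    ∫ s in (0 : ℝ)..α, (κ - s ^ 2) * √((α ^ 2 - s ^ 2) / (c ^ 2 - s ^ 2)) =
      ellipticK (c ^ 2) (α ^ 2) * (α ^ 2 * (c ^ 2 - α ^ 2) / 3) +
        ellipticB (c ^ 2) (α ^ 2) * coeffB (c ^ 2) (α ^ 2) (κ + α ^ 2) 1 := by
  have hC : 0 < c ^ 2 := sq_pos_of_pos (hα.trans hαc)
  have hq : α ^ 2 < c ^ 2 := by gcongr
  have hsubst := integral_mul_sin_subst hα.le (x := 0) (y := π / 2)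
    ⟨by linarith [pi_pos], by positivity⟩ (right_mem_Icc.2 (by linarith [pi_pos]))
    fun s => (κ - s ^ 2) * √((α ^ 2 - s ^ 2) / (c ^ 2 - s ^ 2))
  simp only [sin_zero, sin_pi_div_two, mul_one, mul_zero] at hsubst
  rw [← hsubst, ← coeffK_mul_add (c ^ 2) (α ^ 2) κ]
  refine Eq.trans ?_ (integral_gap hC hq (κ * α ^ 2) (κ + α ^ 2) 1)
  refine integral_congr_Ioo_of_le (by positivity) fun φ hφ => ?_
  obtain ⟨-, hcos⟩ := sin_cos_pos_of_mem_Ioo hφ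
  have hD := ellipticDelta_pos hC hq φ
  have hroot : √((α ^ 2 - (α * sin φ) ^ 2) / (c ^ 2 - (α * sin φ) ^ 2)) =
      α * cos φ / ellipticDelta (c ^ 2) (α ^ 2) φ := by
    rw [show α ^ 2 - (α * sin φ) ^ 2 = (α * cos φ) ^ 2 by rw [mul_pow α (cos φ), cos_sq']; ring,
      sqrt_div (sq_nonneg _), sqrt_sq (by positivity), mul_pow, ellipticDelta]
  simp only [hroot, smul_eq_mul]
  field_simp
  rw [cos_sq']
  ring

theorem integral_ellipticDelta_subst {E : Type*} [NormedAddCommGroup E] [NormedSpace ℝ E]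
    (hα : 0 < α) (hαc : α < c) (f : ℝ → E) :
    ∫ φ in (0 : ℝ)..π / 2, (-((c ^ 2 - α ^ 2) * sin φ * cos φ) /
        ellipticDelta (c ^ 2) (c ^ 2 - α ^ 2) φ) • f (ellipticDelta (c ^ 2) (c ^ 2 - α ^ 2) φ) =
      -∫ s in α..c, f s := by
  have hc : 0 < c := hα.trans hαc
  have hC : 0 < c ^ 2 := sq_pos_of_pos hc
  have hq' : c ^ 2 - α ^ 2 < c ^ 2 := sub_lt_self _ (sq_pos_of_pos hα)
  have hdiff : 0 < c ^ 2 - α ^ 2 := sub_pos.2 (by gcongr)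
  have hzero : ellipticDelta (c ^ 2) (c ^ 2 - α ^ 2) 0 = c := by
    simp [ellipticDelta, sqrt_sq hc.le]
  have hpi : ellipticDelta (c ^ 2) (c ^ 2 - α ^ 2) (π / 2) = α := by
    simp [ellipticDelta, sqrt_sq hα.le]
  have hsubst := integral_deriv_smul_comp_of_deriv_nonpos (a := 0) (b := π / 2) (g := f)
    continuous_ellipticDelta.continuousOn (fun φ _ => hasDerivAt_ellipticDelta hC hq' φ)
    fun φ hφ => by
      rw [min_eq_left (by positivity), max_eq_right (by positivity)] at hφ
      obtain ⟨hsin, hcos⟩ := sin_cos_pos_of_mem_Ioo hφ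
      have hD := ellipticDelta_pos hC hq' φ
      rw [neg_div, Left.neg_nonpos_iff]
      positivity
  rwa [hzero, hpi, intervalIntegral.integral_symm α c] at hsubst

theorem integral_bandEdge_self (hα : 0 < α) (hαc : α < c) (κ : ℝ) :
    ∫ s in α..c, (κ - s ^ 2) * √((s ^ 2 - α ^ 2) / (c ^ 2 - s ^ 2)) =
      -(ellipticK (c ^ 2) (c ^ 2 - α ^ 2) * (α ^ 2 * (c ^ 2 - α ^ 2) / 3) -
        ellipticB (c ^ 2) (c ^ 2 - α ^ 2) * coeffB (c ^ 2) (α ^ 2) (κ + α ^ 2) 1) := by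
  have hc : 0 < c := hα.trans hαc
  have hC : 0 < c ^ 2 := sq_pos_of_pos hc
  have hq0 : 0 < α ^ 2 := sq_pos_of_pos hα
  have hq' : c ^ 2 - α ^ 2 < c ^ 2 := sub_lt_self _ hq0
  have hdiff : 0 < c ^ 2 - α ^ 2 := sub_pos.2 (by gcongr)
  rw [← neg_eq_iff_eq_neg, ← integral_ellipticDelta_subst hα hαc,
    ← coeffK_mul_add (c ^ 2) (α ^ 2) κ]
  refine Eq.trans ?_ (integral_band hC hq0 (κ * α ^ 2) (κ + α ^ 2) 1)
  refine integral_congr_Ioo_of_le (by positivity) fun φ hφ => ?_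
  obtain ⟨hsin, hcos⟩ := sin_cos_pos_of_mem_Ioo hφ
  have hDsq := ellipticDelta_sq hC hq' φ
  have hroot : √((ellipticDelta (c ^ 2) (c ^ 2 - α ^ 2) φ ^ 2 - α ^ 2) /
      (c ^ 2 - ellipticDelta (c ^ 2) (c ^ 2 - α ^ 2) φ ^ 2)) = cos φ / sin φ := by
    rw [hDsq, ← sqrt_sq (div_pos hcos hsin).le, div_pow, cos_sq']
    congr 1
    field_simp
    ring
  have hcos_sq : (c ^ 2 - α ^ 2) * cos φ ^ 2 =
      ellipticDelta (c ^ 2) (c ^ 2 - α ^ 2) φ ^ 2 - α ^ 2 := by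
    rw [hDsq, cos_sq']
    ring
  have hD := ellipticDelta_pos hC hq' φ
  simp only [hroot, smul_eq_mul]
  generalize ellipticDelta (c ^ 2) (c ^ 2 - α ^ 2) φ = D at *
  field_simp
  linear_combination (D ^ 2 - κ) * hcos_sq

theorem isBandEdge_iff :
    IsBandEdge c ξ α ↔ 0 < α ∧ α < c ∧ whithamSpeed (c ^ 2) (α ^ 2) = ξ := by
  refine and_congr_right fun hα => and_congr_right fun hαc => ?_
  have hq : α ^ 2 < c ^ 2 := by gcongr
  have hroot : ∫ s in α..0, ((ξ + (c ^ 2 - α ^ 2) / 2 - s ^ 2 : ℝ) : ℂ) *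
      (((s ^ 2 - α ^ 2) / (c ^ 2 - s ^ 2) : ℝ) : ℂ) ^ (1 / 2 : ℂ) =
      -(Complex.I * (∫ s in (0 : ℝ)..α, (ξ + (c ^ 2 - α ^ 2) / 2 - s ^ 2) *
        √((α ^ 2 - s ^ 2) / (c ^ 2 - s ^ 2)) : ℝ)) := by
    rw [intervalIntegral.integral_symm, ← intervalIntegral.integral_ofReal,
      ← intervalIntegral.integral_const_mul]
    congr 1
    refine intervalIntegral.integral_congr fun s hs => ?_
    rw [uIcc_of_le hα.le] at hs
    have hsα : s ^ 2 ≤ α ^ 2 := pow_le_pow_left₀ hs.1 hs.2 2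
    rw [cpow_half_ofReal_of_nonpos (div_nonpos_of_nonpos_of_nonneg (by linarith) (by linarith)),
      ← neg_div, neg_sub, Complex.ofReal_mul]
    ring
  have hB := ellipticB_pos (sq_pos_of_pos hα) hq
  rw [hroot, neg_eq_zero, mul_eq_zero, or_iff_right Complex.I_ne_zero, Complex.ofReal_eq_zero,
    integral_zero_bandEdge hα hαc, whithamSpeed, coeffB]
  simp only [smul_eq_mul]
  constructor <;> intro h
  · field_simp
    linear_combination (-18) * h
  · rw [← h]
    field_simp
    ring

theorem existsUnique_isBandEdge (hc : 0 < c) (hξ : ξ ∈ Ioo (-c ^ 2 / 2) (c ^ 2 / 3)) :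
    ∃! α : ℝ, IsBandEdge c ξ α := by
  obtain ⟨q, ⟨⟨hq0, hq⟩, hspeed⟩, hunique⟩ := existsUnique_whithamSpeed_eq (sq_pos_of_pos hc) hξ
  refine ⟨√q, isBandEdge_iff.2
    ⟨sqrt_pos.2 hq0, (sqrt_lt' hc).2 hq, by rwa [sq_sqrt hq0.le]⟩, fun α hα => ?_⟩
  obtain ⟨hα0, hαc, hα_speed⟩ := isBandEdge_iff.1 hα
  rw [← hunique (α ^ 2) ⟨⟨by positivity, by gcongr⟩, hα_speed⟩, sqrt_sq hα0.le]

theorem isBandEdge_a (hc : 0 < c) (hξ : ξ ∈ Ioo (-c ^ 2 / 2) (c ^ 2 / 3)) :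
    IsBandEdge c ξ (a c ξ) :=
  Classical.epsilon_spec (existsUnique_isBandEdge hc hξ).exists

theorem a_pos (hc : 0 < c) (hξ : ξ ∈ Ioo (-c ^ 2 / 2) (c ^ 2 / 3)) : 0 < a c ξ :=
  (isBandEdge_a hc hξ).1

theorem a_lt (hc : 0 < c) (hξ : ξ ∈ Ioo (-c ^ 2 / 2) (c ^ 2 / 3)) : a c ξ < c :=
  (isBandEdge_a hc hξ).2.1

theorem a_sq_mem (hc : 0 < c) (hξ : ξ ∈ Ioo (-c ^ 2 / 2) (c ^ 2 / 3)) :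
    a c ξ ^ 2 ∈ Ioo 0 (c ^ 2) :=
  ⟨sq_pos_of_pos (a_pos hc hξ), pow_lt_pow_left₀ (a_lt hc hξ) (a_pos hc hξ).le two_ne_zero⟩

theorem whithamSpeed_a_sq (hc : 0 < c) (hξ : ξ ∈ Ioo (-c ^ 2 / 2) (c ^ 2 / 3)) :
    whithamSpeed (c ^ 2) (a c ξ ^ 2) = ξ :=
  (isBandEdge_iff.1 (isBandEdge_a hc hξ)).2.2

end BandEdge

section Identities

variable {c ξ : ℝ}

theorem h_eq (hc : 0 < c) (hξ : ξ ∈ Ioo (-c ^ 2 / 2) (c ^ 2 / 3)) :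
    h c ξ = (ellipticB (c ^ 2) (a c ξ ^ 2) / ellipticK (c ^ 2) (a c ξ ^ 2) - a c ξ ^ 2 : ℝ) :=
  hOf_eq (a_pos hc hξ) (a_lt hc hξ)

theorem V_eq (hc : 0 < c) (hξ : ξ ∈ Ioo (-c ^ 2 / 2) (c ^ 2 / 3)) :
    V c ξ = (π / ellipticK (c ^ 2) (a c ξ ^ 2) : ℝ) := by
  rw [V, bPeriod_dOmega1 (a_pos hc hξ) (a_lt hc hξ), mul_div_cancel_left₀ _ Complex.I_ne_zero]

theorem W_eq (hc : 0 < c) (hξ : ξ ∈ Ioo (-c ^ 2 / 2) (c ^ 2 / 3)) :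
    W c ξ = ((c ^ 2 + a c ξ ^ 2) / 2 * (π / ellipticK (c ^ 2) (a c ξ ^ 2)) : ℝ) := by
  have hν : IsZeroPair c (a c ξ) (nu c (a c ξ)) :=
    Classical.epsilon_spec (exists_isZeroPair (a_pos hc hξ) (a_lt hc hξ))
  have hb := bPeriod_dOmega3Form (a_pos hc hξ) (a_lt hc hξ) hν
  rw [W, div_eq_iff Complex.I_ne_zero, mul_comm]
  exact hb

theorem Gam_eq (hc : 0 < c) (hξ : ξ ∈ Ioo (-c ^ 2 / 2) (c ^ 2 / 3)) :
    Gam c ξ = -(4 * ellipticK (c ^ 2) (a c ξ ^ 2))⁻¹ := by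
  rw [Gam, integral_inv_sqrt_gap (a_pos hc hξ) (a_lt hc hξ)]
  ring

theorem B_eq_div_ellipticB (hc : 0 < c) (hξ : ξ ∈ Ioo (-c ^ 2 / 2) (c ^ 2 / 3)) :
    B c ξ = -(4 * π) * (a c ξ ^ 2 * (c ^ 2 - a c ξ ^ 2)) / ellipticB (c ^ 2) (a c ξ ^ 2) := by
  obtain ⟨hq0, hq⟩ := a_sq_mem hc hξ
  have hK := (ellipticK_pos (hq0.trans hq) hq).ne'
  have hB := (ellipticB_pos hq0 hq).ne'
  have hspeed := whithamSpeed_a_sq hc hξ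
  rw [B, integral_bandEdge_self (a_pos hc hξ) (a_lt hc hξ)]
  generalize a c ξ ^ 2 = q at *
  have hcoeff : coeffB (c ^ 2) q (ξ + (c ^ 2 - q) / 2 + q) 1 =
      -(ellipticK (c ^ 2) q * (q * (c ^ 2 - q) / 3)) / ellipticB (c ^ 2) q := by
    rw [coeffB, ← hspeed, whithamSpeed, smul_eq_mul]
    field_simp
    ring
  have hgap : ellipticK (c ^ 2) q • (q * (c ^ 2 - q) / 3) +
      ellipticB (c ^ 2) q • coeffB (c ^ 2) q (ξ + (c ^ 2 - q) / 2 + q) 1 = 0 := by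
    rw [hcoeff, smul_eq_mul, smul_eq_mul]
    field_simp
    ring
  have hbilinear := riemann_bilinear hq0 hq hgap
  rw [hcoeff] at hbilinear ⊢
  simp only [smul_eq_mul] at hbilinear
  refine mul_left_cancel₀ hK ?_
  linear_combination (-24) * hbilinear

theorem B_eq_mul_pi_div_ellipticK (hc : 0 < c) (hξ : ξ ∈ Ioo (-c ^ 2 / 2) (c ^ 2 / 3)) :
    B c ξ = (12 * ξ - 2 * (c ^ 2 + a c ξ ^ 2)) * (π / ellipticK (c ^ 2) (a c ξ ^ 2)) := by
  obtain ⟨hq0, hq⟩ := a_sq_mem hc hξ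
  have hK := (ellipticK_pos (hq0.trans hq) hq).ne'
  have hB := (ellipticB_pos hq0 hq).ne'
  rw [B_eq_div_ellipticB hc hξ]
  have hspeed := whithamSpeed_a_sq hc hξ
  rw [whithamSpeed] at hspeed
  field_simp at hspeed ⊢
  linear_combination 2 / 3 * hspeed

theorem hasDerivAt_a_sq (hc : 0 < c) (hξ : ξ ∈ Ioo (-c ^ 2 / 2) (c ^ 2 / 3)) :
    HasDerivAt (fun η => a c η ^ 2) (6 * ellipticB (c ^ 2) (a c ξ ^ 2) ^ 2 /
      (ellipticK (c ^ 2) (a c ξ ^ 2) * whithamFactor (c ^ 2) (a c ξ ^ 2))) ξ := by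
  obtain ⟨hq0, hq⟩ := a_sq_mem hc hξ
  have hK := ellipticK_pos (hq0.trans hq) hq
  have hB := ellipticB_pos hq0 hq
  have hF := whithamFactor_pos hq0 hq
  rw [← inv_div]
  exact hasDerivAt_of_strictMonoOn_of_rightInvOn strictMonoOn_whithamSpeed
    (Ioo_mem_nhds hq0 hq) (Ioo_mem_nhds hξ.1 hξ.2) (fun η hη => a_sq_mem hc hη)
    (fun η hη => whithamSpeed_a_sq hc hη) (hasDerivAt_whithamSpeed hq0 hq) (by positivity)

theorem hasDerivAt_mul_sub_div_ellipticB {C q : ℝ} (hq0 : 0 < q) (hq : q < C) :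
    HasDerivAt (fun p => p * (C - p) / ellipticB C p)
      (-whithamFactor C q / (2 * ellipticB C q ^ 2)) q := by
  have hB0 := (ellipticB_pos hq0 hq).ne'
  refine ((hasDerivAt_id' q).fun_mul ((hasDerivAt_id' q).const_sub C) |>.fun_div
    (hasDerivAt_ellipticB (hq0.trans hq) hq hq0.ne') hB0).congr_deriv ?_
  rw [whithamFactor]
  field_simp
  ring

theorem hasDerivAt_B (hc : 0 < c) (hξ : ξ ∈ Ioo (-c ^ 2 / 2) (c ^ 2 / 3)) :
    HasDerivAt (B c) (12 * (π / ellipticK (c ^ 2) (a c ξ ^ 2))) ξ := by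
  obtain ⟨hq0, hq⟩ := a_sq_mem hc hξ
  have hK := (ellipticK_pos (hq0.trans hq) hq).ne'
  have hB := (ellipticB_pos hq0 hq).ne'
  have hF := (whithamFactor_pos hq0 hq).ne'
  have hB_near : B c =ᶠ[𝓝 ξ] fun η => -(4 * π) *
      (a c η ^ 2 * (c ^ 2 - a c η ^ 2) / ellipticB (c ^ 2) (a c η ^ 2)) := by
    filter_upwards [Ioo_mem_nhds hξ.1 hξ.2] with η hη
    rw [B_eq_div_ellipticB hc hη, mul_div_assoc]
  refine (((hasDerivAt_mul_sub_div_ellipticB hq0 hq).comp ξ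
    (hasDerivAt_a_sq hc hξ)).const_mul (-(4 * π))).congr_of_eventuallyEq hB_near |>.congr_deriv ?_
  field_simp
  ring

theorem hasDerivAt_z (hc : 0 < c) (hξ : ξ ∈ Ioo (-c ^ 2 / 2) (c ^ 2 / 3)) :
    HasDerivAt (z c) (6 * (c ^ 2 + a c ξ ^ 2 + 2 *
      (ellipticB (c ^ 2) (a c ξ ^ 2) / ellipticK (c ^ 2) (a c ξ ^ 2) - a c ξ ^ 2))) ξ := by
  obtain ⟨hq0, hq⟩ := a_sq_mem hc hξ
  have hK := (ellipticK_pos (hq0.trans hq) hq).ne'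
  have hB := (ellipticB_pos hq0 hq).ne'
  have hF := (whithamFactor_pos hq0 hq).ne'
  have hq' := hasDerivAt_a_sq hc hξ
  have hspeed := whithamSpeed_a_sq hc hξ
  have hz : z c = fun η => (12 * η * (c ^ 2 - a c η ^ 2) + 3 * c ^ 4 + 9 * (a c η ^ 2) ^ 2 -
      6 * c ^ 2 * a c η ^ 2) / 2 := by
    funext η
    rw [z]; ring
  rw [hz]
  refine (((((((hasDerivAt_id' ξ).const_mul 12).fun_mul (hq'.const_sub (c ^ 2))).add_const
    (3 * c ^ 4)).fun_add ((hq'.fun_pow 2).const_mul 9)).fun_sub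
    (hq'.const_mul (6 * c ^ 2))).div_const 2).congr_deriv ?_
  generalize a c ξ ^ 2 = q at *
  have hξq : ξ = 3 / 2 * q - c ^ 2 / 2 -
      whithamFactor (c ^ 2) q / (3 * ellipticB (c ^ 2) q) := by
    rw [← sub_whithamSpeed hq0 hq, hspeed, sub_sub_cancel]
  push_cast
  rw [hξq]
  field_simp
  ring

end Identities

end OneGap

end

theorem mainTheorem2 (c : ℝ) (hc : 0 < c) (ξ : ℝ)
    (hξ : ξ ∈ Set.Ioo (-c ^ 2 / 2) (c ^ 2 / 3)) :
    -- the implicitly defined quantities exist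
    (∃! α : ℝ, OneGap.IsBandEdge c ξ α) ∧
    (∃ ν : ℝ × ℝ, OneGap.IsZeroPair c (OneGap.a c ξ) ν) ∧
    -- the identities; stated in `ℂ`, they include that `V`, `W` and `h` are real
    (∀ x t : ℝ, t ≠ 0 → ξ = x / (12 * t) →
      ((t * OneGap.B c ξ : ℝ) : ℂ) = -4 * OneGap.W c ξ * t + OneGap.V c ξ * x) ∧
    (DifferentiableAt ℝ (OneGap.B c) ξ ∧
      ((deriv (OneGap.B c) ξ : ℝ) : ℂ) = 12 * OneGap.V c ξ) ∧
    ((4 * Real.pi * OneGap.Gam c ξ : ℝ) : ℂ) = -OneGap.V c ξ ∧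
    (DifferentiableAt ℝ (OneGap.z c) ξ ∧
      ((1 / 6 * deriv (OneGap.z c) ξ : ℝ) : ℂ) =
        (c : ℂ) ^ 2 + (OneGap.a c ξ : ℂ) ^ 2 + 2 * OneGap.h c ξ) := by
  have hB := OneGap.hasDerivAt_B hc hξ
  have hz := OneGap.hasDerivAt_z hc hξ
  rw [OneGap.V_eq hc hξ, OneGap.W_eq hc hξ, OneGap.h_eq hc hξ, hB.deriv, hz.deriv]
  refine ⟨OneGap.existsUnique_isBandEdge hc hξ,
    OneGap.exists_isZeroPair (OneGap.a_pos hc hξ) (OneGap.a_lt hc hξ), fun x t ht hx => ?_,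
    ⟨hB.differentiableAt, by push_cast; ring⟩, ?_, ⟨hz.differentiableAt, by push_cast; ring⟩⟩
  · have hx' : x = 12 * t * ξ := by rw [hx]; field_simp
    rw [OneGap.B_eq_mul_pi_div_ellipticK hc hξ, hx']
    push_cast
    ring
  · rw [OneGap.Gam_eq hc hξ]
    push_cast
    ring
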